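/- **Setting.** Let $n,m\ge 1$, $d\ge 0$ and $f\ge 0$ be integers with $n>2f$. Worker $i\in[n]$ holds data points $z^{(i)}_1,\dots,z^{(i)}_m\in\mathcal Z$ and has the loss $\mathcal L_i(\theta)=\frac1m\sum_{k=1}^m\ell(\theta,z^{(i)}_k)$, $\theta\in\mathbb R^d$, where $\ell$ is differentiable in $\theta$. Let $\mathcal H\subseteq[n]$, $|\mathcal H|=n-f$, be the set of honest workers and $\mathcal L_{\mathcal H}=\frac1{|\mathcal H|}\sum_{i\in\mathcal H}\mathcal L_i$. Assume that $\nabla\mathcal L_i$ is $L$-Lipschitz for every $i\in\mathcal H$ $(L>0)$, and that $(G,B)$-gradient dissimilarity holds with $G,B>0$: $$\frac1{|\mathcal H|}\sum_{i\in\mathcal H}\|\nabla\mathcal L_i(\theta)-\nabla\mathcal L_{\mathcal H}(\theta)\|^2\le G^2+B^2\|\nabla\mathcal L_{\mathcal H}(\theta)\|^2\quad\text{for all }\theta .$$ **Aggregation.** For $C\ge0$ let $\mathrm{clip}_C(x)=\min(1,C/\|x\|)\,x$. $\mathbf{ARC}(x_1,\dots,x_n)$ replaces every $x_i$ by $\mathrm{clip}_C(x_i)$,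 where $C$ is the $(k+1)$-th largest of the norms $\|x_1\|,\dots,\|x_n\|$ and $k=\lfloor 2\frac fn(n-f)\rfloor$. $\mathbf{NNM}$ (nearest neighbor mixing) replaces every $x_i$ by the average of the $n-f$ vectors nearest to $x_i$ ($x_i$ included). Let $\mathbf F=\mathbf F_0\circ\mathbf{NNM}$, where $\mathbf F_0$ is one of: the coordinate-wise trimmed mean (in each coordinate the $f$ smallest and the $f$ largest values are dropped and the rest averaged), the coordinate-wise median, the geometric median (a minimizer of $z\mapsto\sum_i\|x_i-z\|$), Multi-Krum (the average of the $q$ vectors with the smallest scores, for some $1\le q\le n-f$, the score of $x_i$ being the sum of its squared distances to its $n-f$ nearest vectors, $x_i$ included). Ties are broken arbitrarily. The server uses $\mathbf F^\dagger(x_1,\dots,x_n)=\mathrm{clip}_{\max_i\|x_i\|}(\mathbf F(x_1,\dots,x_n))$, which equals $\mathbf F$ whenever $\|\mathbf F(x_1,\dots,x_n)\|\le\max_i\|x_i\|$ always holds. Let $\kappa$ be a real number such that $\mathbf F^\dagger$ is $(f,\kappa)$-robust, i.e., for all $x_1,\dots,x_n\in\mathbb R^d$ and all $S\subseteq[n]$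 with $|S|=n-f$, with $\overline x_S=\frac1{|S|}\sum_{i\in S}x_i$, $$\|\mathbf F^\dagger(x_1,\dots,x_n)-\overline x_S\|^2\le\frac{\kappa}{|S|}\sum_{i\in S}\|x_i-\overline x_S\|^2 ,$$ and such that either $\kappa\le\frac{8f}{n-f}\bigl(1+(1+\frac f{n-2f})^2\bigr)$ or $\kappa$ is the smallest number with this property. **Algorithm (Robust-DGD with ARC).** Start at $\theta_1\in\mathbb R^d$. In step $t=1,\dots,T$ (with $T\ge1$) each honest worker $i$ sends $g^{(i)}_t=\nabla\mathcal L_i(\theta_t)$, the other workers send arbitrary vectors, and $\theta_{t+1}=\theta_t-\gamma\,\mathbf F^\dagger(\mathbf{ARC}(g^{(1)}_t,\dots,g^{(n)}_t))$. The output $\hat\theta$ is chosen uniformly at random from $\theta_1,\dots,\theta_T$. **Constants.** Suppose that $\mathcal L_{\mathcal H}$ is bounded below with infimum $\mathcal L_{\mathcal H}^*$, that $\mathcal L_{\mathcal H}(\theta_1)-\mathcal L_{\mathcal H}^*\le\Delta_o$, and that $\max_{i\in\mathcal H}\|\nabla\mathcal L_i(\theta_1)\|\le\zeta$. Let $\gamma=\min\{\frac{\Delta_o}{\kappa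 G^2}\cdot\frac1T,\frac1L\}$ and $T\ge\frac{\Delta_oL}{\kappa G^2}$. Let $\xi_o\in(0,1)$ and $$\rho=\exp\Bigl(\frac{(2+B^2)\Delta_o}{(1-\xi_o)G^2}L\Bigr)\zeta,\qquad \mathsf{BP}=\frac1{2+B^2},$$ $$\varepsilon_o=\frac14\cdot\frac{G^2(f/n)}{1-(2+B^2)(f/n)},\qquad \Psi(G,B,\rho)=640\Bigl(1+\frac1{B^2}\Bigr)^2\Bigl(1+\frac{B^2\rho^2}{G^2}\Bigr).$$ **Theorem.** Whatever the vectors sent by the workers outside $\mathcal H$: 1. If $\frac fn=(1-\xi)\mathsf{BP}$ with $\xi\in(0,\xi_o]$, then $\mathbb E\|\nabla\mathcal L_{\mathcal H}(\hat\theta)\|^2\le\xi\,\Psi(G,B,\rho)\,\varepsilon_o$. 2. If $\mathsf{BP}\le\frac fn<\frac12$, then $\mathbb E\|\nabla\mathcal L_{\mathcal H}(\hat\theta)\|^2\le\Psi(G,B,\rho)\cdot\frac{G^2}8$. -/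

import Mathlib

open MeasureTheory ProbabilityTheory

noncomputable section

namespace ARC

/-! ### Averages, clipping and adaptive robust clipping -/

/-- The parameter space `ℝ^d` with the Euclidean norm. -/
abbrev Vec (d : ℕ) : Type := EuclideanSpace ℝ (Fin d)

/-- The average of the vectors `x i`, `i ∈ S`. -/
def avg {n d : ℕ} (S : Finset (Fin n)) (x : Fin n → Vec d) : Vec d :=
  (S.card : ℝ)⁻¹ • ∑ i ∈ S, x i

/-- `clip_C(x) = min(1, C / ‖x‖) x`. (For `x = 0` the value is `0`.) -/
def clip {d : ℕ} (C : ℝ) (x : Vec d) : Vec d := min 1 (C / ‖x‖) • x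

/-- The number `k = ⌊2 (f/n) (n - f)⌋` of vectors that ARC clips. -/
def arcCount (n f : ℕ) : ℕ := ⌊2 * ((f : ℝ) / n) * ((n : ℝ) - f)⌋₊

/-- A permutation that lists the vectors by nonincreasing norm. -/
def normOrder {n d : ℕ} (x : Fin n → Vec d) : Equiv.Perm (Fin n) :=
  Tuple.sort (fun i => -‖x i‖)

/-- The clipping threshold of ARC: the `(k+1)`-th largest norm among the inputs. (Positions are
counted from `0`; one has `k < n` whenever `2 f < n`.) -/
def arcThreshold {n d : ℕ} (f : ℕ) (x : Fin n → Vec d) : ℝ :=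
  if h : arcCount n f < n then ‖x (normOrder x ⟨arcCount n f, h⟩)‖ else 0

/-- Adaptive robust clipping. -/
def arc {n d : ℕ} (f : ℕ) (x : Fin n → Vec d) : Fin n → Vec d :=
  fun i => clip (arcThreshold f x) (x i)

/-! ### Robust aggregation -/

/-- `(f, κ)`-robustness of an aggregation rule. -/
def IsRobust {n d : ℕ} (f : ℕ) (κ : ℝ) (F : (Fin n → Vec d) → Vec d) : Prop :=
  ∀ (x : Fin n → Vec d) (S : Finset (Fin n)), S.card = n - f →
    ‖F x - avg S x‖ ^ 2 ≤ κ / (S.card : ℝ) * ∑ i ∈ S, ‖x i - avg S x‖ ^ 2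

/-- The increasing rearrangement of a finite family of reals. -/
def sorted {n : ℕ} (v : Fin n → ℝ) : Fin n → ℝ := fun k => v (Tuple.sort v k)

/-- Trimmed mean: drop the `f` smallest and the `f` largest values, average the other `n - 2f`. -/
def trimmedMean {n : ℕ} (f : ℕ) (v : Fin n → ℝ) : ℝ :=
  ((n : ℝ) - 2 * f)⁻¹ *
    ∑ k ∈ Finset.univ.filter (fun k : Fin n => f ≤ (k : ℕ) ∧ (k : ℕ) < n - f), sorted v k

/-- Median: the middle value for odd `n`, the mean of the two middle values for even `n`. -/
def median {n : ℕ} (v : Fin n → ℝ) : ℝ :=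
  if h : 0 < n then
    (sorted v ⟨(n - 1) / 2, by omega⟩ + sorted v ⟨n / 2, by omega⟩) / 2
  else 0

/-- Coordinate-wise trimmed mean. -/
def cwtm {n d : ℕ} (f : ℕ) (x : Fin n → Vec d) : Vec d :=
  WithLp.toLp 2 (fun j => trimmedMean f (fun i => x i j))

/-- Coordinate-wise median. -/
def cwmed {n d : ℕ} (x : Fin n → Vec d) : Vec d :=
  WithLp.toLp 2 (fun j => median (fun i => x i j))

/-- `F` is a geometric median: `F x` minimizes `z ↦ ∑ i, ‖x i - z‖`. -/
def IsGeometricMedian {n d : ℕ} (F : (Fin n → Vec d) → Vec d) : Prop :=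
  ∀ x : Fin n → Vec d, ∀ z : Vec d, ∑ i, ‖x i - F x‖ ≤ ∑ i, ‖x i - z‖

/-- `N` indexes `m` of the vectors that are nearest to `x i` (`x i` itself is counted, ties are
broken arbitrarily). -/
def IsNearest {n d : ℕ} (m : ℕ) (x : Fin n → Vec d) (i : Fin n) (N : Finset (Fin n)) : Prop :=
  N.card = m ∧ ∀ j ∈ N, ∀ l ∉ N, ‖x j - x i‖ ≤ ‖x l - x i‖

/-- `F` is a Multi-Krum rule that averages `q` vectors: the score of `x i` is the sum of the squared
distances from `x i` to its `n - f` nearest vectors, and `F x` is the average of `q` vectors with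
the smallest scores (ties are broken arbitrarily). For `q = 1` this is Krum. -/
def IsMultiKrum {n d : ℕ} (f q : ℕ) (F : (Fin n → Vec d) → Vec d) : Prop :=
  ∀ x : Fin n → Vec d, ∃ N : Fin n → Finset (Fin n), (∀ i, IsNearest (n - f) x i (N i)) ∧
    ∃ P : Finset (Fin n), P.card = q ∧
      (∀ i ∈ P, ∀ l ∉ P, ∑ j ∈ N i, ‖x j - x i‖ ^ 2 ≤ ∑ j ∈ N l, ‖x j - x l‖ ^ 2) ∧
      F x = avg P x

/-- `M` is nearest neighbor mixing: each vector is replaced by the average of its `n - f` nearest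
vectors (ties are broken arbitrarily). -/
def IsNNM {n d : ℕ} (f : ℕ) (M : (Fin n → Vec d) → Fin n → Vec d) : Prop :=
  ∀ (x : Fin n → Vec d) (i : Fin n), ∃ N : Finset (Fin n),
    IsNearest (n - f) x i N ∧ M x i = avg N x

/-- `F` is one of CWTM, CWMed, GM, MK. -/
def IsBaseRule {n d : ℕ} (f : ℕ) (F : (Fin n → Vec d) → Vec d) : Prop :=
  F = cwtm f ∨ F = cwmed ∨ IsGeometricMedian F ∨
    ∃ q : ℕ, 1 ≤ q ∧ q ≤ n - f ∧ IsMultiKrum f q F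

/-- The largest norm among the inputs. -/
def maxNorm {n d : ℕ} (x : Fin n → Vec d) : ℝ := ⨆ i, ‖x i‖

/-- The norm-capped rule `x ↦ clip_C (F x)` with `C = max_i ‖x i‖`. -/
def normCap {n d : ℕ} (F : (Fin n → Vec d) → Vec d) : (Fin n → Vec d) → Vec d :=
  fun x => clip (maxNorm x) (F x)

/-- Capping changes nothing for a rule whose output is never longer than its longest input. -/
theorem normCap_eq_self {n d : ℕ} (F : (Fin n → Vec d) → Vec d)
    (hF : ∀ x, ‖F x‖ ≤ maxNorm x) : normCap F = F := by
  funext x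
  unfold normCap clip
  rcases eq_or_ne (F x) 0 with h | h
  · simp [h]
  · have h1 : (1 : ℝ) ≤ maxNorm x / ‖F x‖ := by
      rw [le_div_iff₀ (norm_pos_iff.mpr h), one_mul]
      exact hF x
    rw [min_eq_left h1, one_smul]

/-- The known robustness coefficient of `F ∘ NNM`, `F ∈ {CWTM, CWMed, GM, MK}`. -/
def kappaBound (n f : ℕ) : ℝ :=
  8 * (f : ℝ) / ((n : ℝ) - f) * (1 + (1 + (f : ℝ) / ((n : ℝ) - 2 * f)) ^ 2)

/-! ### Losses -/

/-- The local loss of worker `i`: the average point-wise loss over its `m` data points. -/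
def localLoss {n d m : ℕ} {Z : Type*} (ℓ : Vec d → Z → ℝ) (D : Fin n → Fin m → Z) (i : Fin n)
    (θ : Vec d) : ℝ :=
  (m : ℝ)⁻¹ * ∑ k, ℓ θ (D i k)

/-- The average `𝓛_H` of the local losses over the set `H` of honest workers. -/
def honestLoss {n d : ℕ} (Lc : Fin n → Vec d → ℝ) (H : Finset (Fin n)) (θ : Vec d) : ℝ :=
  (H.card : ℝ)⁻¹ * ∑ i ∈ H, Lc i θ

/-- Lipschitz smoothness with constant `L`. -/
def IsSmooth {d : ℕ} (L : ℝ) (g : Vec d → ℝ) : Prop :=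
  ∀ θ θ' : Vec d, ‖gradient g θ - gradient g θ'‖ ≤ L * ‖θ - θ'‖

/-- `(G, B)`-gradient dissimilarity of the honest losses. -/
def GradientDissimilarity {n d : ℕ} (Lc : Fin n → Vec d → ℝ) (H : Finset (Fin n)) (G B : ℝ) :
    Prop :=
  ∀ θ : Vec d,
    (H.card : ℝ)⁻¹ * ∑ i ∈ H, ‖gradient (Lc i) θ - gradient (honestLoss Lc H) θ‖ ^ 2
      ≤ G ^ 2 + B ^ 2 * ‖gradient (honestLoss Lc H) θ‖ ^ 2

/-! ### Robust distributed gradient descent -/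

/-- `θ 1, …, θ (T+1)` are the models and `g t i` the vectors sent by worker `i` at step `t` in an
execution of Robust-DGD with aggregation `R`, learning rate `γ` and `T` steps. The vectors sent by
workers outside `H` are arbitrary. -/
structure IsRobustDGD {n d : ℕ} (Lc : Fin n → Vec d → ℝ) (H : Finset (Fin n))
    (R : (Fin n → Vec d) → Vec d) (γ : ℝ) (T : ℕ) (θ : ℕ → Vec d) (g : ℕ → Fin n → Vec d) :
    Prop where
  honest : ∀ t, 1 ≤ t → t ≤ T → ∀ i ∈ H, g t i = gradient (Lc i) (θ t)
  step : ∀ t, 1 ≤ t → t ≤ T → θ (t + 1) = θ t - γ • R (g t)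

/-- The law of the output, chosen uniformly at random from `θ 1, …, θ T`. -/
def outputLaw {d : ℕ} (θ : ℕ → Vec d) (T : ℕ) : Measure (Vec d) :=
  (uniformOn (Set.Icc 1 T)).map θ

/-- The expected squared gradient norm of `Φ` at the output. -/
def expectedSqGrad {d : ℕ} (Φ : Vec d → ℝ) (θ : ℕ → Vec d) (T : ℕ) : ℝ :=
  ∫ θhat, ‖gradient Φ θhat‖ ^ 2 ∂(outputLaw θ T)

/-! ### The constants of the theorem -/

/-- The breakdown point `BP = 1 / (2 + B²)`. -/
def breakdownPoint (B : ℝ) : ℝ := 1 / (2 + B ^ 2)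

/-- `ε_o`, the lower bound on the error under `(G, B)`-gradient dissimilarity. -/
def epsO (n f : ℕ) (G B : ℝ) : ℝ :=
  1 / 4 * (G ^ 2 * ((f : ℝ) / n) / (1 - (2 + B ^ 2) * ((f : ℝ) / n)))

/-- `Ψ(G, B, ρ)`. -/
def Psi (G B ρ : ℝ) : ℝ :=
  640 * (1 + 1 / B ^ 2) ^ 2 * (1 + B ^ 2 * ρ ^ 2 / G ^ 2)

end ARC

end

/-!
The output is judged by the average of `‖∇𝓛_H‖²` along the trajectory, and two facts control it.

*Boundedness.* Adaptive clipping at a threshold reached by more than `f` vectors, followed by a rule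
whose output is no longer than its longest input, never moves the model by more than the step size
times the longest honest gradient (`norm_normCap_arc_le`). By smoothness the longest honest gradient
grows by a factor of at most `1 + γ L` per step, and `κ ≥ f / (n - 2 f)` (`IsRobust.le_coefficient`)
bounds `γ L T`, so all honest gradients stay below `ρ`
(`IsRobustDGD.norm_gradient_le_exp`). As `(1 + 1 / B²)² B² ≥ 4`, this alone gives the second
assertion, and the first one when `f / n ≥ 1 / 640`.

*Accuracy for `f / n < 1 / 640`.* Descent with the inexact gradient gives an average of at most
`2 κ G² + κ' (G² + B² ρ²)`, where `κ'` is the robustness coefficient of the aggregation composed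
with clipping (`average_sq_gradient_le`). It remains to see that `2 κ + κ' ≤ 160 f / n`.

* `κ' = κ + 2 f / (n - 2 f)` (`IsRobust.comp_arc`): clipping is firmly nonexpansive, so
  displacing the mean of the honest vectors costs them variance (`variance_clip_add_le`), and the
  two errors do not add up in norm.
* `κ ≤ 48 f / (n - 2 f)` (`coefficient_le`): mixing brings the honest vectors to within
  `8 f / (n - f)` times their variance of their average
  (`IsNearest.norm_avg_sub_avg_sq_le`), each base rule stays close to any center around which
  `n - f` of its inputs concentrate (`IsBaseRule.isCentered`), and capping the norm is a projection
  onto a ball that contains the honest average, so it does no harm (`IsRobust.normCap`).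
-/

namespace ARC

/-! ### Averages and variances -/

section Averages

variable {n d : ℕ}

theorem card_smul_avg {S : Finset (Fin n)} (hS : S.Nonempty) (x : Fin n → Vec d) :
    (S.card : ℝ) • avg S x = ∑ i ∈ S, x i := by
  have h : (S.card : ℝ) ≠ 0 := by exact_mod_cast hS.card_pos.ne'
  rw [avg, smul_inv_smul₀ h]

theorem sum_sub_avg {S : Finset (Fin n)} (hS : S.Nonempty) (x : Fin n → Vec d) :
    ∑ i ∈ S, (x i - avg S x) = 0 := by
  rw [Finset.sum_sub_distrib, Finset.sum_const, ← Nat.cast_smul_eq_nsmul ℝ, card_smul_avg hS,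
    sub_self]

/-- Decomposition of the mean squared deviation from `c` into variance and squared bias. -/
theorem sum_norm_sub_sq {S : Finset (Fin n)} (hS : S.Nonempty) (x : Fin n → Vec d) (c : Vec d) :
    ∑ i ∈ S, ‖x i - c‖ ^ 2
      = ∑ i ∈ S, ‖x i - avg S x‖ ^ 2 + S.card * ‖avg S x - c‖ ^ 2 := by
  have h : ∀ i, ‖x i - c‖ ^ 2 = ‖x i - avg S x‖ ^ 2
      + 2 * inner ℝ (x i - avg S x) (avg S x - c) + ‖avg S x - c‖ ^ 2 := fun i => by
    rw [← norm_add_sq_real, sub_add_sub_cancel]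
  simp only [h, Finset.sum_add_distrib, ← Finset.mul_sum, ← sum_inner, sum_sub_avg hS,
    inner_zero_left, Finset.sum_const, nsmul_eq_mul]
  ring

theorem sum_sum_norm_sub_sq {S : Finset (Fin n)} (hS : S.Nonempty) (x : Fin n → Vec d) :
    ∑ i ∈ S, ∑ j ∈ S, ‖x j - x i‖ ^ 2 = 2 * S.card * ∑ i ∈ S, ‖x i - avg S x‖ ^ 2 := by
  simp only [sum_norm_sub_sq hS x (x _), Finset.sum_add_distrib, ← Finset.mul_sum,
    Finset.sum_const, nsmul_eq_mul, norm_sub_rev (avg S x)]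
  ring

theorem sum_norm_sub_avg_sq_le {S : Finset (Fin n)} (hS : S.Nonempty) (x : Fin n → Vec d)
    (c : Vec d) : ∑ i ∈ S, ‖x i - avg S x‖ ^ 2 ≤ ∑ i ∈ S, ‖x i - c‖ ^ 2 := by
  rw [sum_norm_sub_sq hS x c]
  have : 0 ≤ (S.card : ℝ) * ‖avg S x - c‖ ^ 2 := by positivity
  linarith

theorem norm_avg_sub_sq_le {S : Finset (Fin n)} (hS : S.Nonempty) (x : Fin n → Vec d)
    (c : Vec d) : S.card * ‖avg S x - c‖ ^ 2 ≤ ∑ i ∈ S, ‖x i - c‖ ^ 2 := by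
  rw [sum_norm_sub_sq hS x c]
  have : 0 ≤ ∑ i ∈ S, ‖x i - avg S x‖ ^ 2 := by positivity
  linarith

theorem norm_avg_le {S : Finset (Fin n)} (x : Fin n → Vec d) {C : ℝ} (hC : 0 ≤ C)
    (h : ∀ i ∈ S, ‖x i‖ ≤ C) : ‖avg S x‖ ≤ C := by
  rcases S.eq_empty_or_nonempty with rfl | hS
  · simpa [avg] using hC
  have hs : (0 : ℝ) < S.card := by exact_mod_cast hS.card_pos
  rw [avg, norm_smul, norm_inv, Real.norm_natCast, inv_mul_le_iff₀ hs]
  calc ‖∑ i ∈ S, x i‖ ≤ ∑ i ∈ S, ‖x i‖ := norm_sum_le _ _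
    _ ≤ ∑ _i ∈ S, C := Finset.sum_le_sum h
    _ = S.card * C := by simp

theorem norm_sum_sq_le_of_support {S P : Finset (Fin n)} (hPS : P ⊆ S) {k : ℕ} (hk : P.card ≤ k)
    {v : Fin n → Vec d} (hv : ∀ i ∈ S, i ∉ P → v i = 0) :
    ‖∑ i ∈ S, v i‖ ^ 2 ≤ k * ∑ i ∈ S, ‖v i‖ ^ 2 := by
  have hk' : (P.card : ℝ) ≤ k := by exact_mod_cast hk
  rw [← Finset.sum_subset hPS hv]
  calc ‖∑ i ∈ P, v i‖ ^ 2 ≤ (∑ i ∈ P, ‖v i‖) ^ 2 :=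
        pow_le_pow_left₀ (norm_nonneg _) (norm_sum_le _ _) 2
    _ ≤ P.card * ∑ i ∈ P, ‖v i‖ ^ 2 := sq_sum_le_card_mul_sum_sq
    _ ≤ k * ∑ i ∈ S, ‖v i‖ ^ 2 := mul_le_mul hk'
        (Finset.sum_le_sum_of_subset_of_nonneg hPS fun i _ _ => sq_nonneg _)
        (Finset.sum_nonneg fun i _ => sq_nonneg _) (Nat.cast_nonneg k)

end Averages

/-! ### Clipping as a projection -/

section Clipping

variable {d : ℕ}

theorem clip_of_norm_le {C : ℝ} {x : Vec d} (h : ‖x‖ ≤ C) : clip C x = x := by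
  rcases eq_or_ne x 0 with rfl | hx
  · simp [clip]
  · rw [clip, min_eq_left, one_smul]
    rwa [le_div_iff₀ (norm_pos_iff.mpr hx), one_mul]

theorem clip_of_le_norm {C : ℝ} {x : Vec d} (h : C ≤ ‖x‖) :
    clip C x = (C / ‖x‖) • x := by
  rw [clip, min_eq_right]
  exact div_le_one_of_le₀ h (norm_nonneg x)

theorem norm_clip_le {C : ℝ} (hC : 0 ≤ C) (x : Vec d) : ‖clip C x‖ ≤ C := by
  rcases le_total ‖x‖ C with h | h
  · rwa [clip_of_norm_le h]
  · rw [clip_of_le_norm h, norm_smul, Real.norm_of_nonneg (by positivity)]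
    rcases eq_or_ne ‖x‖ 0 with h0 | h0
    · simpa [h0] using hC
    · rw [div_mul_cancel₀ _ h0]

/-- The variational inequality that characterizes `clip C` as the projection onto the ball of
radius `C`. -/
theorem inner_sub_clip_nonpos {C : ℝ} (hC : 0 ≤ C) (x : Vec d) {z : Vec d} (hz : ‖z‖ ≤ C) :
    inner ℝ (z - clip C x) (x - clip C x) ≤ 0 := by
  rcases le_or_gt ‖x‖ C with h | h
  · simp [clip_of_norm_le h]
  have hx : 0 < ‖x‖ := hC.trans_lt h
  have e : x - clip C x = (1 - C / ‖x‖) • x := by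
    rw [clip_of_le_norm h.le, sub_smul, one_smul]
  have h1 : 0 ≤ 1 - C / ‖x‖ := sub_nonneg.2 (div_le_one_of_le₀ h.le hx.le)
  have h2 : inner ℝ z x ≤ C * ‖x‖ :=
    (real_inner_le_norm z x).trans (mul_le_mul_of_nonneg_right hz hx.le)
  have h3 : inner ℝ (clip C x) x = C * ‖x‖ := by
    rw [clip_of_le_norm h.le, real_inner_smul_left, real_inner_self_eq_norm_sq]
    field_simp
  rw [e, real_inner_smul_right, inner_sub_left, h3]
  exact mul_nonpos_of_nonneg_of_nonpos h1 (by linarith)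

theorem norm_clip_sub_le {C : ℝ} (hC : 0 ≤ C) (x : Vec d) {c : Vec d} (hc : ‖c‖ ≤ C) :
    ‖clip C x - c‖ ^ 2 ≤ ‖x - c‖ ^ 2 := by
  have h := inner_sub_clip_nonpos hC x hc
  have e : x - c = (x - clip C x) - (c - clip C x) := by abel
  rw [e, norm_sub_sq_real (x - clip C x), norm_sub_rev (clip C x) c, real_inner_comm]
  nlinarith [sq_nonneg ‖x - clip C x‖]

/-- Clipping is firmly nonexpansive. -/
theorem clip_firmly_nonexpansive {C : ℝ} (hC : 0 ≤ C) (x y : Vec d) :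
    ‖clip C x - clip C y‖ ^ 2 + ‖(x - clip C x) - (y - clip C y)‖ ^ 2 ≤ ‖x - y‖ ^ 2 := by
  have h1 := inner_sub_clip_nonpos hC x (norm_clip_le hC y)
  have h2 := inner_sub_clip_nonpos hC y (norm_clip_le hC x)
  have e : x - y = (clip C x - clip C y) + ((x - clip C x) - (y - clip C y)) := by abel
  have e2 : inner ℝ (clip C x - clip C y) ((x - clip C x) - (y - clip C y))
      = - inner ℝ (clip C y - clip C x) (x - clip C x)
        - inner ℝ (clip C x - clip C y) (y - clip C y) := by
    rw [inner_sub_right, ← neg_sub (clip C y) (clip C x), inner_neg_left]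
  rw [e, norm_add_sq_real, e2]
  linarith

end Clipping

/-! ### Capping the norm of the output -/

section NormCap

variable {n d : ℕ}

theorem norm_le_maxNorm (x : Fin n → Vec d) (i : Fin n) : ‖x i‖ ≤ maxNorm x :=
  le_ciSup (f := fun i => ‖x i‖) (Set.finite_range _).bddAbove i

theorem maxNorm_nonneg (x : Fin n → Vec d) : 0 ≤ maxNorm x :=
  Real.iSup_nonneg fun _ => norm_nonneg _

theorem norm_normCap_le (F : (Fin n → Vec d) → Vec d) (x : Fin n → Vec d) :
    ‖normCap F x‖ ≤ maxNorm x :=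
  norm_clip_le (maxNorm_nonneg x) _

theorem IsRobust.normCap {f : ℕ} {κ : ℝ} {F : (Fin n → Vec d) → Vec d} (h : IsRobust f κ F) :
    IsRobust f κ (normCap F) := fun x S hS =>
  (norm_clip_sub_le (maxNorm_nonneg x) (F x)
    (norm_avg_le x (maxNorm_nonneg x) fun i _ => norm_le_maxNorm x i)).trans (h x S hS)

end NormCap

/-! ### Adaptive clipping -/

section Arc

variable {n d f : ℕ}

theorem arcThreshold_nonneg (x : Fin n → Vec d) : 0 ≤ arcThreshold f x := by
  unfold arcThreshold
  split_ifs <;> simp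

theorem arcCount_le (hn : 2 * f < n) : (arcCount n f : ℝ) ≤ 2 * f * (n - f) / n := by
  have h1 : (2 * f : ℝ) < n := by exact_mod_cast hn
  have h2 : (0 : ℝ) ≤ f := by positivity
  refine (Nat.floor_le ?_).trans_eq (by ring)
  exact mul_nonneg (by positivity) (by linarith)

theorem arcCount_lt (hn : 2 * f < n) : arcCount n f < n := by
  have h1 : (2 * f : ℝ) < n := by exact_mod_cast hn
  have h2 : (0 : ℝ) ≤ f := by positivity
  have h3 := arcCount_le hn
  have h4 : 2 * f * (n - f) / n < (n : ℝ) := by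
    rw [div_lt_iff₀ (by linarith)]
    nlinarith
  exact_mod_cast h3.trans_lt h4

theorem le_arcCount (hn : 2 * f < n) : f ≤ arcCount n f := by
  have h1 : (2 * f : ℝ) < n := by exact_mod_cast hn
  have h2 : (0 : ℝ) ≤ f := by positivity
  refine Nat.le_floor ?_
  rw [mul_assoc, div_mul_eq_mul_div, mul_div_assoc', le_div_iff₀ (by linarith)]
  nlinarith

theorem antitone_norm_normOrder (x : Fin n → Vec d) : Antitone fun k => ‖x (normOrder x k)‖ :=
  fun _ _ h => neg_le_neg_iff.1 (Tuple.monotone_sort (fun i => -‖x i‖) h)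

/-- At most `k` vectors are longer than the threshold. -/
theorem card_arcThreshold_lt_le (hn : 2 * f < n) (x : Fin n → Vec d) :
    (Finset.univ.filter fun i => arcThreshold f x < ‖x i‖).card ≤ arcCount n f := by
  set k : Fin n := ⟨arcCount n f, arcCount_lt hn⟩
  have hC : arcThreshold f x = ‖x (normOrder x k)‖ := dif_pos (arcCount_lt hn)
  calc (Finset.univ.filter fun i => arcThreshold f x < ‖x i‖).card
      ≤ ((Finset.Iio k).map (normOrder x).toEmbedding).card := by
        refine Finset.card_le_card fun i hi => ?_
        rw [Finset.mem_map_equiv, Finset.mem_Iio]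
        by_contra h
        have := antitone_norm_normOrder x (not_lt.1 h)
        simp only [Equiv.apply_symm_apply] at this
        simp only [Finset.mem_filter, hC] at hi
        exact absurd hi.2 (not_lt.2 this)
    _ = arcCount n f := by rw [Finset.card_map, Fin.card_Iio]

/-- Since more than `f` vectors reach the threshold, one of any `n - f` vectors does. -/
theorem exists_arcThreshold_le (hn : 2 * f < n) (x : Fin n → Vec d) {S : Finset (Fin n)}
    (hS : S.card = n - f) : ∃ i ∈ S, arcThreshold f x ≤ ‖x i‖ := by
  set k : Fin n := ⟨arcCount n f, arcCount_lt hn⟩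
  have hC : arcThreshold f x = ‖x (normOrder x k)‖ := dif_pos (arcCount_lt hn)
  set P := (Finset.Iic k).map (normOrder x).toEmbedding
  have hP : P.card = arcCount n f + 1 := by rw [Finset.card_map, Fin.card_Iic]
  have hPS : ¬ Disjoint S P := fun h => by
    have h1 := Finset.card_union_of_disjoint h
    have h2 := Finset.card_le_univ (S ∪ P)
    have h3 := le_arcCount hn
    rw [Fintype.card_fin] at h2
    omega
  obtain ⟨i, hi, hi'⟩ := Finset.not_disjoint_iff.1 hPS
  refine ⟨i, hi, ?_⟩
  rw [Finset.mem_map_equiv, Finset.mem_Iic] at hi'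
  have := antitone_norm_normOrder x hi'
  simpa only [Equiv.apply_symm_apply, hC] using this

/-- Clipping at a threshold exceeded by at most `k` of `s` vectors: the variance lost by clipping
dominates `(s - k) / k` times the squared displacement of the mean. Indeed clipping is firmly
nonexpansive, so that the variances of the clipped vectors and of the displacements add up to at
most the original one, and the displacements are supported on at most `k` indices. -/
theorem variance_clip_add_le {C : ℝ} (hC : 0 ≤ C) (x : Fin n → Vec d) {S : Finset (Fin n)}
    (hS : S.Nonempty) {k : ℕ} (hk : (S.filter fun i => C < ‖x i‖).card ≤ k) :
    k * ∑ i ∈ S, ‖clip C (x i) - avg S (fun j => clip C (x j))‖ ^ 2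
        + S.card * (S.card - k) * ‖avg S (fun j => clip C (x j)) - avg S x‖ ^ 2
      ≤ k * ∑ i ∈ S, ‖x i - avg S x‖ ^ 2 := by
  set y : Fin n → Vec d := fun j => clip C (x j) with hy
  set δ : Fin n → Vec d := fun j => x j - clip C (x j) with hδ
  have hs : (0 : ℝ) < S.card := by exact_mod_cast hS.card_pos
  have hpair : ∑ i ∈ S, ‖y i - avg S y‖ ^ 2 + ∑ i ∈ S, ‖δ i - avg S δ‖ ^ 2
      ≤ ∑ i ∈ S, ‖x i - avg S x‖ ^ 2 := by
    have h : ∑ i ∈ S, ∑ j ∈ S, ‖y j - y i‖ ^ 2 + ∑ i ∈ S, ∑ j ∈ S, ‖δ j - δ i‖ ^ 2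
        ≤ ∑ i ∈ S, ∑ j ∈ S, ‖x j - x i‖ ^ 2 := by
      simp only [← Finset.sum_add_distrib]
      exact Finset.sum_le_sum fun i _ => Finset.sum_le_sum fun j _ =>
        clip_firmly_nonexpansive hC (x j) (x i)
    simp only [sum_sum_norm_sub_sq hS] at h
    rw [← mul_add] at h
    exact le_of_mul_le_mul_left h (by positivity)
  have havg : avg S δ = avg S x - avg S y := by
    simp only [avg, hδ, hy, Finset.sum_sub_distrib, smul_sub]
  have hzero := sum_norm_sub_sq hS δ 0
  simp only [sub_zero] at hzero
  have hcs : (S.card : ℝ) ^ 2 * ‖avg S δ‖ ^ 2 ≤ k * ∑ i ∈ S, ‖δ i‖ ^ 2 := by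
    have e : (S.card : ℝ) ^ 2 * ‖avg S δ‖ ^ 2 = ‖∑ i ∈ S, δ i‖ ^ 2 := by
      rw [← card_smul_avg hS, norm_smul, Real.norm_natCast, mul_pow]
    rw [e]
    refine norm_sum_sq_le_of_support (Finset.filter_subset _ _) hk fun i hi hi' => ?_
    have : ‖x i‖ ≤ C := not_lt.1 fun h => hi' (Finset.mem_filter.2 ⟨hi, h⟩)
    simp [hδ, clip_of_norm_le this]
  rw [norm_sub_rev (avg S y), ← havg]
  have hk0 := mul_le_mul_of_nonneg_left hpair (Nat.cast_nonneg (α := ℝ) k)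
  rw [hzero] at hcs
  linarith

/-- Precomposition with adaptive clipping preserves robustness, at the price of adding
`2 f / (n - 2 f)` to the coefficient. -/
theorem IsRobust.comp_arc {κ : ℝ} {A : (Fin n → Vec d) → Vec d} (hA : IsRobust f κ A)
    (hκ : 0 ≤ κ) (hf : 0 < f) (hn : 2 * f < n) :
    IsRobust f (κ + 2 * f / (n - 2 * f)) (A ∘ arc f) := by
  intro x S hS
  have hf' : (0 : ℝ) < f := by exact_mod_cast hf
  have hn' : (2 * f : ℝ) < n := by exact_mod_cast hn
  have hS' : S.Nonempty := Finset.card_pos.1 (by omega)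
  have hs : (0 : ℝ) < S.card := by exact_mod_cast hS'.card_pos
  have hsn : (S.card : ℝ) = n - f := by rw [hS, Nat.cast_sub (by omega)]
  set k := arcCount n f
  have hk : (0 : ℝ) < k := by exact_mod_cast hf.trans_le (le_arcCount hn)
  have hvar := variance_clip_add_le (arcThreshold_nonneg (f := f) x) x hS' (k := k)
    ((Finset.card_le_card (Finset.filter_subset_filter _ (Finset.subset_univ S))).trans
      (card_arcThreshold_lt_le hn x))
  have hrob := hA (arc f x) S hS
  set y := arc f x with hy
  change k * ∑ i ∈ S, ‖y i - avg S y‖ ^ 2 + S.card * (S.card - k) * ‖avg S y - avg S x‖ ^ 2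
    ≤ _ at hvar
  set V := ∑ i ∈ S, ‖x i - avg S x‖ ^ 2
  set V' := ∑ i ∈ S, ‖y i - avg S y‖ ^ 2
  set w := ‖avg S y - avg S x‖
  set u := ‖A y - avg S y‖
  set σ : ℝ := 2 * f / (n - 2 * f) with hσ
  have hσ0 : 0 < σ := div_pos (by linarith) (by linarith)
  have hratio : k ≤ σ * (S.card - k) := by
    have h := arcCount_le hn
    rw [le_div_iff₀ (by linarith)] at h
    rw [hσ, div_mul_eq_mul_div, le_div_iff₀ (by linarith), hsn]
    nlinarith
  have hV : V' + S.card * (w ^ 2 / σ) ≤ V := by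
    have h1 : k * (S.card * (w ^ 2 / σ)) ≤ S.card * (S.card - k) * w ^ 2 := by
      have : k * (w ^ 2 / σ) ≤ (S.card - k) * w ^ 2 := by
        rw [mul_div_assoc', div_le_iff₀ hσ0]
        nlinarith [sq_nonneg w]
      nlinarith
    exact le_of_mul_le_mul_left (by linarith) hk
  have htri : ‖(A ∘ arc f) x - avg S x‖ ≤ u + w := by
    simpa only [Function.comp] using norm_sub_le_norm_sub_add_norm_sub (A y) (avg S y) (avg S x)
  -- weighted Cauchy-Schwarz: `(u + w)² ≤ (κ + σ) (v + w² / σ)` whenever `u² ≤ κ v`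
  have hcs : ∀ v : ℝ, 0 ≤ v → u ^ 2 ≤ κ * v → (u + w) ^ 2 ≤ (κ + σ) * (v + w ^ 2 / σ) := by
    intro v hv huv
    obtain ⟨r, hr⟩ : ∃ r, r = w / σ := ⟨_, rfl⟩
    have hw : w = σ * r := by rw [hr]; field_simp
    have hr0 : 0 ≤ r := hr ▸ div_nonneg (norm_nonneg _) hσ0.le
    have e : w ^ 2 / σ = σ * r ^ 2 := by rw [hw]; field_simp
    have h2 : 2 * u * r ≤ v + κ * r ^ 2 := by
      refine abs_le_of_sq_le_sq' ?_ (by positivity) |>.2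
      nlinarith [sq_nonneg (v - κ * r ^ 2), mul_le_mul_of_nonneg_right huv (sq_nonneg r)]
    rw [e, hw]
    nlinarith
  have h1 := hcs (V' / S.card) (by positivity) (by rwa [mul_div_assoc', ← div_mul_eq_mul_div])
  calc ‖(A ∘ arc f) x - avg S x‖ ^ 2 ≤ (u + w) ^ 2 := by gcongr
    _ ≤ (κ + σ) * (V' / S.card + w ^ 2 / σ) := h1
    _ = (κ + σ) / S.card * (V' + S.card * (w ^ 2 / σ)) := by field_simp
    _ ≤ (κ + σ) / S.card * V := by gcongr

/-- The output of a capped rule after adaptive clipping is no longer than the longest honest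
vector. -/
theorem norm_normCap_arc_le (hn : 2 * f < n) (F : (Fin n → Vec d) → Vec d) (x : Fin n → Vec d)
    {S : Finset (Fin n)} (hS : S.card = n - f) {b : ℝ} (hb : ∀ i ∈ S, ‖x i‖ ≤ b) :
    ‖normCap F (arc f x)‖ ≤ b := by
  obtain ⟨i, hi, hi'⟩ := exists_arcThreshold_le hn x hS
  have : Nonempty (Fin n) := ⟨i⟩
  exact (norm_normCap_le F _).trans
    (ciSup_le fun j => (norm_clip_le (arcThreshold_nonneg x) (x j)).trans (hi'.trans (hb i hi)))

end Arc

/-! ### Nearest neighbor mixing -/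

section Mixing

variable {n d f : ℕ}

/-- The average of `g` over a set of indices with the smallest values is at most its average over
any set that is at least as large. -/
theorem card_mul_sum_le_of_smallest {ι : Type*} [DecidableEq ι] {P S : Finset ι} {g : ι → ℝ}
    (hPS : P.card ≤ S.card) (hP : ∀ i ∈ P, ∀ l ∉ P, g i ≤ g l) :
    S.card * ∑ i ∈ P, g i ≤ P.card * ∑ i ∈ S, g i := by
  rcases P.eq_empty_or_nonempty with rfl | hne
  · simp
  obtain ⟨i₀, hi₀, hmax⟩ := P.exists_max_image g hne
  -- `τ` separates the values on `P` from those off `P`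
  set τ := g i₀
  have h1 : ∑ i ∈ P, (g i - τ) ≤ 0 := Finset.sum_nonpos fun i hi => sub_nonpos.2 (hmax i hi)
  have h2 : ∑ i ∈ P, (g i - τ) ≤ ∑ i ∈ S, (g i - τ) := by
    rw [← Finset.sum_inter_add_sum_sdiff P S, ← Finset.sum_inter_add_sum_sdiff S P,
      Finset.inter_comm]
    have h3 : ∑ i ∈ P \ S, (g i - τ) ≤ 0 :=
      Finset.sum_nonpos fun i hi => sub_nonpos.2 (hmax i (Finset.mem_sdiff.1 hi).1)
    have h4 : 0 ≤ ∑ i ∈ S \ P, (g i - τ) :=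
      Finset.sum_nonneg fun i hi => sub_nonneg.2 (hP i₀ hi₀ i (Finset.mem_sdiff.1 hi).2)
    linarith
  have h3 : (P.card : ℝ) ≤ S.card := by exact_mod_cast hPS
  have h4 : (S.card : ℝ) * ∑ i ∈ P, (g i - τ) ≤ P.card * ∑ i ∈ S, (g i - τ) :=
    (mul_le_mul_of_nonpos_right h3 h1).trans (mul_le_mul_of_nonneg_left h2 (Nat.cast_nonneg _))
  simp only [Finset.sum_sub_distrib, Finset.sum_const, nsmul_eq_mul] at h4
  linarith

theorem IsNearest.sum_le {m : ℕ} {x : Fin n → Vec d} {i : Fin n} {N S : Finset (Fin n)}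
    (hN : IsNearest m x i N) (hS : S.card = m) {φ : ℝ → ℝ} (hφ : MonotoneOn φ (Set.Ici 0)) :
    ∑ j ∈ N, φ ‖x j - x i‖ ≤ ∑ j ∈ S, φ ‖x j - x i‖ := by
  rcases S.eq_empty_or_nonempty with rfl | hne
  · rw [Finset.card_empty] at hS
    rw [Finset.card_eq_zero.1 (hN.1.trans hS.symm)]
  have h := card_mul_sum_le_of_smallest (P := N) (S := S) (g := fun j => φ ‖x j - x i‖)
    (hN.1.trans hS.symm).le fun j hj l hl => hφ (norm_nonneg _) (norm_nonneg _) (hN.2 j hj l hl)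
  rw [hN.1, ← hS] at h
  exact le_of_mul_le_mul_left h (by exact_mod_cast hne.card_pos)

/-- The `n - f` vectors nearest to `x i` and those indexed by `S` differ in at most `f` places, and
an outsider among the former is no farther from `x i` than a vector of `S` that it displaces. -/
theorem IsNearest.norm_avg_sub_avg_sq_le {x : Fin n → Vec d} {i : Fin n} {N S : Finset (Fin n)}
    (hN : IsNearest (n - f) x i N) (hf : f < n) (hS : S.card = n - f) :
    ((n : ℝ) - f) ^ 2 * ‖avg N x - avg S x‖ ^ 2 ≤ 4 * f * ∑ j ∈ S, ‖x j - x i‖ ^ 2 := by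
  have hcard : ((n : ℝ) - f) = S.card := by rw [hS, Nat.cast_sub hf.le]
  have hSne : S.Nonempty := Finset.card_pos.1 (by omega)
  have hNne : N.Nonempty := Finset.card_pos.1 (by rw [hN.1]; omega)
  have hNS : N.card = S.card := hN.1.trans hS.symm
  have hsum : (S.card : ℝ) • (avg N x - avg S x)
      = ∑ j ∈ N \ S, (x j - x i) - ∑ j ∈ S \ N, (x j - x i) := by
    have h1 : (S.card : ℝ) • (avg N x - avg S x) = ∑ j ∈ N, (x j - x i) - ∑ j ∈ S, (x j - x i) := by
      rw [smul_sub, card_smul_avg hSne, ← hNS, card_smul_avg hNne, Finset.sum_sub_distrib,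
        Finset.sum_sub_distrib, Finset.sum_const, Finset.sum_const, hNS]
      abel
    rw [h1, ← Finset.sum_inter_add_sum_sdiff N S, ← Finset.sum_inter_add_sum_sdiff S N,
      Finset.inter_comm S N]
    abel
  have hle : ∑ j ∈ N \ S, ‖x j - x i‖ ≤ ∑ j ∈ S \ N, ‖x j - x i‖ := by
    have h := hN.sum_le hS (φ := id) monotoneOn_id
    simp only [id] at h
    rw [← Finset.sum_inter_add_sum_sdiff N S, ← Finset.sum_inter_add_sum_sdiff S N,
      Finset.inter_comm S N] at h
    linarith
  have hcf : (S \ N).card ≤ f := by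
    have h1 := Finset.card_le_univ (S ∪ N)
    rw [Fintype.card_fin] at h1
    have h2 := Finset.card_sdiff_add_card S N
    have h3 := hN.1
    omega
  have hnorm : S.card * ‖avg N x - avg S x‖ ≤ 2 * ∑ j ∈ S \ N, ‖x j - x i‖ := by
    have h1 : S.card * ‖avg N x - avg S x‖ = ‖(S.card : ℝ) • (avg N x - avg S x)‖ := by
      rw [norm_smul, Real.norm_natCast]
    rw [h1, hsum]
    have h2 := norm_sub_le (∑ j ∈ N \ S, (x j - x i)) (∑ j ∈ S \ N, (x j - x i))
    have h3 := norm_sum_le (N \ S) fun j => x j - x i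
    have h4 := norm_sum_le (S \ N) fun j => x j - x i
    linarith
  have hcs : (∑ j ∈ S \ N, ‖x j - x i‖) ^ 2 ≤ f * ∑ j ∈ S, ‖x j - x i‖ ^ 2 :=
    sq_sum_le_card_mul_sum_sq.trans (mul_le_mul (by exact_mod_cast hcf)
      (Finset.sum_le_sum_of_subset_of_nonneg Finset.sdiff_subset fun j _ _ => sq_nonneg _)
      (Finset.sum_nonneg fun j _ => sq_nonneg _) (Nat.cast_nonneg f))
  rw [hcard, ← mul_pow]
  have := pow_le_pow_left₀ (by positivity) hnorm 2
  rw [mul_pow 2] at this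
  linarith

/-- `F` stays close to every center around which some `n - f` of its inputs concentrate. The center
`c` need not be the average of those inputs, and the constant is normalized by `n - 2 f`. -/
def IsCentered {n d : ℕ} (f : ℕ) (K : ℝ) (F : (Fin n → Vec d) → Vec d) : Prop :=
  ∀ (y : Fin n → Vec d) (S : Finset (Fin n)), S.card = n - f → ∀ c : Vec d,
    ((n : ℝ) - 2 * f) * ‖F y - c‖ ^ 2 ≤ K * ∑ i ∈ S, ‖y i - c‖ ^ 2

/-- After mixing, the vectors of `S` deviate from the original average by at most `8 f / (n - f)`
times the original variance, so a centered rule becomes robust with a coefficient of order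
`f / n`. -/
theorem IsCentered.isRobust_comp_nnm {K : ℝ} (hK : 0 ≤ K) {F : (Fin n → Vec d) → Vec d}
    (hF : IsCentered f K F) {M : (Fin n → Vec d) → Fin n → Vec d} (hM : IsNNM f M)
    (hn : 2 * f < n) : IsRobust f (8 * K * f / (n - 2 * f)) (F ∘ M) := by
  intro x S hS
  have hSne : S.Nonempty := Finset.card_pos.1 (by omega)
  have hs : (0 : ℝ) < S.card := by exact_mod_cast hSne.card_pos
  have hcard : (S.card : ℝ) = n - f := by rw [hS, Nat.cast_sub (by omega)]
  have hn' : (0 : ℝ) < n - 2 * f := by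
    have : (2 * f : ℝ) < n := by exact_mod_cast hn
    linarith
  have h1 : (S.card : ℝ) ^ 2 * ∑ i ∈ S, ‖M x i - avg S x‖ ^ 2
      ≤ 8 * f * S.card * ∑ i ∈ S, ‖x i - avg S x‖ ^ 2 := by
    calc (S.card : ℝ) ^ 2 * ∑ i ∈ S, ‖M x i - avg S x‖ ^ 2
        ≤ ∑ i ∈ S, 4 * f * ∑ j ∈ S, ‖x j - x i‖ ^ 2 := by
          rw [Finset.mul_sum]
          refine Finset.sum_le_sum fun i _ => ?_
          obtain ⟨N, hN, hMN⟩ := hM x i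
          rw [hMN, hcard]
          exact hN.norm_avg_sub_avg_sq_le (by omega) hS
      _ = 8 * f * S.card * ∑ i ∈ S, ‖x i - avg S x‖ ^ 2 := by
          rw [← Finset.mul_sum, sum_sum_norm_sub_sq hSne]
          ring
  have h2 := hF (M x) S hS (avg S x)
  set W := ∑ i ∈ S, ‖M x i - avg S x‖ ^ 2
  set V := ∑ i ∈ S, ‖x i - avg S x‖ ^ 2
  have h3 : W ≤ 8 * f / S.card * V := by
    rw [div_mul_eq_mul_div, le_div_iff₀ hs]
    refine le_of_mul_le_mul_left ?_ hs
    linarith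
  have h4 := mul_le_mul_of_nonneg_left h3 hK
  have e : 8 * K * f / (n - 2 * f) / S.card * V = K * (8 * f / S.card * V) / (n - 2 * f) := by
    field_simp
  rw [e, le_div_iff₀ hn', mul_comm]
  exact h2.trans h4

end Mixing

/-! ### Order statistics -/

section OrderStatistics

theorem StrictMono.fin_val_bounds {m n : ℕ} {e : Fin m → Fin n} (he : StrictMono e) (k : Fin m) :
    (k : ℕ) ≤ e k ∧ (e k : ℕ) + m ≤ k + n := by
  constructor
  · have h : ((Finset.Iio k).map ⟨e, he.injective⟩).card ≤ (Finset.Iio (e k)).card :=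
      Finset.card_le_card fun i hi => by
        obtain ⟨j, hj, rfl⟩ := Finset.mem_map.1 hi
        exact Finset.mem_Iio.2 (he (Finset.mem_Iio.1 hj))
    rwa [Finset.card_map, Fin.card_Iio, Fin.card_Iio] at h
  · have h : ((Finset.Ioi k).map ⟨e, he.injective⟩).card ≤ (Finset.Ioi (e k)).card :=
      Finset.card_le_card fun i hi => by
        obtain ⟨j, hj, rfl⟩ := Finset.mem_map.1 hi
        exact Finset.mem_Ioi.2 (he (Finset.mem_Ioi.1 hj))
    rw [Finset.card_map, Fin.card_Ioi, Fin.card_Ioi] at h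
    omega

variable {n f : ℕ}

theorem monotone_sorted (v : Fin n → ℝ) : Monotone (sorted v) := Tuple.monotone_sort v

/-- Interlacing: if `u` lists the values on `S`, `|S| = n - f`, in increasing order, then the `k`-th
value of `v` is at most `u k` and the `(k + f)`-th is at least `u k`. -/
theorem exists_interlacing (v : Fin n → ℝ) {S : Finset (Fin n)} (hS : S.card = n - f) :
    ∃ u : Fin (n - f) → ℝ, Monotone u ∧ (∀ g : ℝ → ℝ, ∑ k, g (u k) = ∑ i ∈ S, g (v i)) ∧
      (∀ (k : Fin n) (hk : (k : ℕ) < n - f), sorted v k ≤ u ⟨k, hk⟩) ∧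
      ∀ (k : Fin n) (hk : (k : ℕ) - f < n - f), f ≤ k → u ⟨k - f, hk⟩ ≤ sorted v k := by
  have hS' : (S.map (Tuple.sort v).symm.toEmbedding).card = n - f := by rw [Finset.card_map, hS]
  set e := (S.map (Tuple.sort v).symm.toEmbedding).orderEmbOfFin hS' with he
  refine ⟨fun k => sorted v (e k), (monotone_sorted v).comp e.monotone, fun g => ?_,
    fun k hk => monotone_sorted v ?_, fun k hk hfk => monotone_sorted v ?_⟩
  · calc ∑ k, g (sorted v (e k))
        = ∑ k ∈ Finset.univ.map e.toEmbedding, g (sorted v k) := by rw [Finset.sum_map]; rfl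
      _ = ∑ k ∈ S.map (Tuple.sort v).symm.toEmbedding, g (sorted v k) := by
        rw [he, Finset.map_orderEmbOfFin_univ]
      _ = ∑ i ∈ S, g (v i) := by
        rw [Finset.sum_map]
        simp [sorted]
  · exact Fin.le_def.2 (StrictMono.fin_val_bounds e.strictMono ⟨k, hk⟩).1
  · have := (StrictMono.fin_val_bounds e.strictMono ⟨(k : ℕ) - f, hk⟩).2
    refine Fin.le_def.2 ?_
    simp only at this
    omega

/-- By interlacing, each of the retained values is squeezed between two values on `S`. -/
theorem trimmedMean_sub_sq_le (hn : 2 * f < n) (v : Fin n → ℝ) {S : Finset (Fin n)}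
    (hS : S.card = n - f) (c : ℝ) :
    ((n : ℝ) - 2 * f) * (trimmedMean f v - c) ^ 2 ≤ 2 * ∑ i ∈ S, (v i - c) ^ 2 := by
  obtain ⟨u, -, hsum, hup, hlow⟩ := exists_interlacing v hS
  set P := Finset.univ.filter fun k : Fin n => f ≤ (k : ℕ) ∧ (k : ℕ) < n - f with hP
  have hPcard : (P.card : ℝ) = n - 2 * f := by
    have : P.map Fin.valEmbedding = Finset.Ico f (n - f) := by
      ext k
      simp only [hP, Finset.mem_map, Finset.mem_filter, Finset.mem_univ, true_and,
        Fin.valEmbedding_apply, Finset.mem_Ico]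
      exact ⟨fun ⟨a, ha, h⟩ => h ▸ ha, fun h => ⟨⟨k, by omega⟩, h, rfl⟩⟩
    rw [← Finset.card_map Fin.valEmbedding, this, Nat.card_Ico, Nat.sub_sub,
      Nat.cast_sub (by omega)]
    push_cast
    ring
  have hn' : (0 : ℝ) < n - 2 * f := by
    have : (2 * f : ℝ) < n := by exact_mod_cast hn
    linarith
  set U : ℕ → ℝ := fun k => if h : k < n - f then (u ⟨k, h⟩ - c) ^ 2 else 0 with hU
  have hU0 : ∀ k, 0 ≤ U k := fun k => by
    simp only [hU]
    split_ifs <;> positivity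
  have hUsum : ∑ k ∈ Finset.range (n - f), U k = ∑ i ∈ S, (v i - c) ^ 2 := by
    rw [← hsum fun t => (t - c) ^ 2, ← Fin.sum_univ_eq_sum_range]
    exact Finset.sum_congr rfl fun k _ => by simp [hU]
  have hinj : ∀ φ : Fin n → ℕ, Set.InjOn φ P → (∀ k ∈ P, φ k < n - f) →
      ∑ k ∈ P, U (φ k) ≤ ∑ i ∈ S, (v i - c) ^ 2 := fun φ hφ hφ' => by
    rw [← hUsum, ← Finset.sum_image hφ]
    exact Finset.sum_le_sum_of_subset_of_nonneg
      (fun k hk => by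
        obtain ⟨j, hj, rfl⟩ := Finset.mem_image.1 hk
        exact Finset.mem_range.2 (hφ' j hj)) fun k _ _ => hU0 k
  have hterm : ∀ k ∈ P, (sorted v k - c) ^ 2 ≤ U (k - f) + U k := fun k hk => by
    obtain ⟨h1, h2⟩ := (Finset.mem_filter.1 hk).2
    have h3 : (k : ℕ) - f < n - f := by omega
    have h4 := hup k h2
    have h5 := hlow k h3 h1
    simp only [hU, dif_pos h2, dif_pos h3]
    rcases le_total c (sorted v k) with h | h <;>
      nlinarith [sq_nonneg (u ⟨k, h2⟩ - c), sq_nonneg (u ⟨k - f, h3⟩ - c)]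
  have hmean : ((n : ℝ) - 2 * f) * (trimmedMean f v - c) = ∑ k ∈ P, (sorted v k - c) := by
    rw [Finset.sum_sub_distrib, Finset.sum_const, nsmul_eq_mul, hPcard, trimmedMean, mul_sub,
      mul_inv_cancel_left₀ hn'.ne']
  have hcs : (∑ k ∈ P, (sorted v k - c)) ^ 2 ≤ P.card * ∑ k ∈ P, (sorted v k - c) ^ 2 :=
    sq_sum_le_card_mul_sum_sq
  have h1 : ∑ k ∈ P, (sorted v k - c) ^ 2 ≤ 2 * ∑ i ∈ S, (v i - c) ^ 2 := by
    have h2 := Finset.sum_le_sum hterm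
    rw [Finset.sum_add_distrib] at h2
    have h3 := hinj (fun k => k - f)
      (fun a ha b hb hab => by
        have ha' := (Finset.mem_filter.1 ha).2
        have hb' := (Finset.mem_filter.1 hb).2
        simp only at hab
        exact Fin.ext (by omega))
      fun k hk => by have := (Finset.mem_filter.1 hk).2; omega
    have h4 := hinj (fun k => k) Fin.val_injective.injOn fun k hk => (Finset.mem_filter.1 hk).2.2
    linarith
  rw [← hmean, hPcard, mul_pow, pow_two ((n : ℝ) - 2 * f), mul_assoc] at hcs
  exact (le_of_mul_le_mul_left hcs hn').trans h1

/-- A central order statistic has at least `(n - 2 f) / 2` of the values on `S` on either side. -/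
theorem sorted_sub_sq_le (hn : 2 * f < n) (v : Fin n → ℝ) {S : Finset (Fin n)}
    (hS : S.card = n - f) (c : ℝ) (k : Fin n) (hk : n ≤ 2 * k + 2) (hk' : 2 * (k : ℕ) ≤ n) :
    ((n : ℝ) - 2 * f) * (sorted v k - c) ^ 2 ≤ 2 * ∑ i ∈ S, (v i - c) ^ 2 := by
  obtain ⟨u, hmono, hsum, hup, hlow⟩ := exists_interlacing v hS
  rw [← hsum fun t => (t - c) ^ 2]
  have key : ∀ P : Finset (Fin (n - f)), n ≤ 2 * P.card + 2 * f →
      (∀ j ∈ P, (sorted v k - c) ^ 2 ≤ (u j - c) ^ 2) →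
      ((n : ℝ) - 2 * f) * (sorted v k - c) ^ 2 ≤ 2 * ∑ j, (u j - c) ^ 2 := fun P hP h => by
    have h1 : P.card * (sorted v k - c) ^ 2 ≤ ∑ j, (u j - c) ^ 2 := by
      rw [← nsmul_eq_mul, ← Finset.sum_const]
      exact (Finset.sum_le_sum h).trans (Finset.sum_le_sum_of_subset_of_nonneg
        (Finset.subset_univ P) fun j _ _ => sq_nonneg _)
    have h2 : (n : ℝ) ≤ 2 * P.card + 2 * f := by exact_mod_cast hP
    nlinarith [sq_nonneg (sorted v k - c)]
  rcases le_total c (sorted v k) with h | h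
  · have h1 : (k : ℕ) < n - f := by omega
    refine key (Finset.Ici ⟨k, h1⟩) ?_ fun j hj => ?_
    · rw [Fin.card_Ici]
      simp only
      omega
    · have := (hup k h1).trans (hmono (Finset.mem_Ici.1 hj))
      nlinarith
  · have h1 : (k : ℕ) - f < n - f := by omega
    refine key (Finset.Iic ⟨(k : ℕ) - f, h1⟩) ?_ fun j hj => ?_
    · rw [Fin.card_Iic]
      simp only
      omega
    · have := (hmono (Finset.mem_Iic.1 hj)).trans (hlow k h1 (by omega))
      nlinarith

theorem median_sub_sq_le (hn : 2 * f < n) (v : Fin n → ℝ) {S : Finset (Fin n)}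
    (hS : S.card = n - f) (c : ℝ) :
    ((n : ℝ) - 2 * f) * (median v - c) ^ 2 ≤ 2 * ∑ i ∈ S, (v i - c) ^ 2 := by
  have h0 : 0 < n := by omega
  have hn' : (0 : ℝ) < n - 2 * f := by
    have : (2 * f : ℝ) < n := by exact_mod_cast hn
    linarith
  have h1 := sorted_sub_sq_le hn v hS c ⟨(n - 1) / 2, by omega⟩ (by simp only; omega)
    (by simp only; omega)
  have h2 := sorted_sub_sq_le hn v hS c ⟨n / 2, by omega⟩ (by simp only; omega)
    (by simp only; omega)
  rw [median, dif_pos h0]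
  set a := sorted v ⟨(n - 1) / 2, _⟩
  set b := sorted v ⟨n / 2, _⟩
  have h3 : ((a + b) / 2 - c) ^ 2 ≤ ((a - c) ^ 2 + (b - c) ^ 2) / 2 := by
    nlinarith [sq_nonneg (a - b)]
  have := mul_le_mul_of_nonneg_left h3 hn'.le
  linarith

end OrderStatistics

/-! ### The base rules -/

section BaseRules

variable {n d f : ℕ}

theorem isCentered_of_coordinatewise {K : ℝ} (a : (Fin n → ℝ) → ℝ)
    (ha : ∀ (v : Fin n → ℝ) (S : Finset (Fin n)), S.card = n - f → ∀ c : ℝ,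
      ((n : ℝ) - 2 * f) * (a v - c) ^ 2 ≤ K * ∑ i ∈ S, (v i - c) ^ 2) :
    IsCentered f K fun x : Fin n → Vec d => WithLp.toLp 2 fun j => a fun i => x i j := by
  intro y S hS c
  simp only [EuclideanSpace.real_norm_sq_eq, PiLp.sub_apply]
  rw [Finset.sum_comm, Finset.mul_sum, Finset.mul_sum]
  exact Finset.sum_le_sum fun j _ => ha (fun i => y i j) S hS (c j)

theorem isCentered_cwtm (hn : 2 * f < n) : IsCentered f 2 (cwtm f : (Fin n → Vec d) → Vec d) :=
  isCentered_of_coordinatewise _ fun v _ hS c => trimmedMean_sub_sq_le hn v hS c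

theorem isCentered_cwmed (hn : 2 * f < n) : IsCentered f 2 (cwmed : (Fin n → Vec d) → Vec d) :=
  isCentered_of_coordinatewise _ fun v _ hS c => median_sub_sq_le hn v hS c

theorem IsGeometricMedian.isCentered {F : (Fin n → Vec d) → Vec d} (hF : IsGeometricMedian F)
    (hn : 2 * f < n) : IsCentered f (4 * (n - f) / (n - 2 * f)) F := by
  intro y S hS c
  have hn' : (0 : ℝ) < n - 2 * f := by
    have : (2 * f : ℝ) < n := by exact_mod_cast hn
    linarith
  have hcard : (S.card : ℝ) = n - f := by rw [hS, Nat.cast_sub (by omega)]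
  have hcard' : ((Sᶜ : Finset (Fin n)).card : ℝ) = f := by
    rw [Finset.card_compl, hS, Fintype.card_fin, Nat.sub_sub_self (by omega)]
  set r := ‖F y - c‖
  have hopt := hF y c
  rw [← Finset.sum_add_sum_compl S, ← Finset.sum_add_sum_compl S (fun i => ‖y i - c‖)] at hopt
  have h1 : ∑ i ∈ S, (r - ‖y i - c‖) ≤ ∑ i ∈ S, ‖y i - F y‖ := Finset.sum_le_sum fun i _ => by
    have := norm_sub_le_norm_sub_add_norm_sub (F y) (y i) c
    rw [norm_sub_rev (F y) (y i)] at this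
    linarith
  have h2 : ∑ i ∈ Sᶜ, (‖y i - c‖ - r) ≤ ∑ i ∈ Sᶜ, ‖y i - F y‖ := Finset.sum_le_sum fun i _ => by
    have := norm_sub_le_norm_sub_add_norm_sub (y i) (F y) c
    linarith
  simp only [Finset.sum_sub_distrib, Finset.sum_const, nsmul_eq_mul, hcard, hcard'] at h1 h2
  have h3 : ((n : ℝ) - 2 * f) * r ≤ 2 * ∑ i ∈ S, ‖y i - c‖ := by linarith
  have h4 := pow_le_pow_left₀ (by positivity) h3 2
  have h5 : (∑ i ∈ S, ‖y i - c‖) ^ 2 ≤ S.card * ∑ i ∈ S, ‖y i - c‖ ^ 2 :=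
    sq_sum_le_card_mul_sum_sq
  rw [hcard] at h5
  rw [div_mul_eq_mul_div, le_div_iff₀ hn']
  rw [mul_pow, mul_pow] at h4
  linarith

theorem IsMultiKrum.isCentered {q : ℕ} {F : (Fin n → Vec d) → Vec d} (hF : IsMultiKrum f q F)
    (hq : 1 ≤ q) (hq' : q ≤ n - f) (hn : 2 * f < n) : IsCentered f 6 F := by
  intro y S hS c
  obtain ⟨N, hN, P, hP, hscore, hFy⟩ := hF y
  have hSne : S.Nonempty := Finset.card_pos.1 (by omega)
  have hPne : P.Nonempty := Finset.card_pos.1 (by omega)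
  have hs : (0 : ℝ) < S.card := by exact_mod_cast hSne.card_pos
  have hp : (0 : ℝ) < P.card := by exact_mod_cast hPne.card_pos
  have hn' : (0 : ℝ) < n - 2 * f := by
    have : (2 * f : ℝ) < n := by exact_mod_cast hn
    linarith
  set D := ∑ i ∈ S, ‖y i - c‖ ^ 2
  -- the selected scores are at most twice `D` on average
  have hsum : ∑ i ∈ P, ∑ j ∈ N i, ‖y j - y i‖ ^ 2 ≤ P.card * (2 * D) := by
    have h1 := card_mul_sum_le_of_smallest (S := S)
      (g := fun i => ∑ j ∈ N i, ‖y j - y i‖ ^ 2) (by omega) hscore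
    have h2 : ∑ i ∈ S, ∑ j ∈ N i, ‖y j - y i‖ ^ 2 ≤ ∑ i ∈ S, ∑ j ∈ S, ‖y j - y i‖ ^ 2 :=
      Finset.sum_le_sum fun i _ => (hN i).sum_le hS (φ := fun t => t ^ 2)
        fun a ha b _ hab => pow_le_pow_left₀ ha hab 2
    rw [sum_sum_norm_sub_sq hSne] at h2
    have h3 := mul_le_mul_of_nonneg_left (sum_norm_sub_avg_sq_le hSne y c)
      (mul_nonneg zero_le_two hs.le)
    have h4 := mul_le_mul_of_nonneg_left (h2.trans h3) hp.le
    refine le_of_mul_le_mul_left ((h1.trans h4).trans_eq ?_) hs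
    ring
  -- at least `n - 2 f` of the neighbors of each vector lie in `S`
  have hterm : ∀ i, ((n : ℝ) - 2 * f) * ‖y i - c‖ ^ 2
      ≤ 2 * ∑ j ∈ N i, ‖y j - y i‖ ^ 2 + 2 * D := fun i => by
    have hQ : (n : ℝ) - 2 * f ≤ (N i ∩ S).card := by
      have h1 := Finset.card_le_univ (N i ∪ S)
      rw [Fintype.card_fin] at h1
      have h2 := Finset.card_union_add_card_inter (N i) S
      have h3 := (hN i).1
      have h4 : n ≤ (N i ∩ S).card + 2 * f := by omega
      have h5 : (n : ℝ) ≤ (N i ∩ S).card + 2 * f := by exact_mod_cast h4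
      linarith
    have h1 : ∀ j, ‖y i - c‖ ^ 2 ≤ 2 * ‖y j - y i‖ ^ 2 + 2 * ‖y j - c‖ ^ 2 := fun j => by
      have h2 := norm_sub_le_norm_sub_add_norm_sub (y i) (y j) c
      rw [norm_sub_rev (y i) (y j)] at h2
      have h3 := pow_le_pow_left₀ (norm_nonneg _) h2 2
      nlinarith [sq_nonneg (‖y j - y i‖ - ‖y j - c‖)]
    calc ((n : ℝ) - 2 * f) * ‖y i - c‖ ^ 2 ≤ (N i ∩ S).card * ‖y i - c‖ ^ 2 :=
          mul_le_mul_of_nonneg_right hQ (sq_nonneg _)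
      _ = ∑ j ∈ N i ∩ S, ‖y i - c‖ ^ 2 := by rw [Finset.sum_const, nsmul_eq_mul]
      _ ≤ ∑ j ∈ N i ∩ S, (2 * ‖y j - y i‖ ^ 2 + 2 * ‖y j - c‖ ^ 2) :=
          Finset.sum_le_sum fun j _ => h1 j
      _ = 2 * ∑ j ∈ N i ∩ S, ‖y j - y i‖ ^ 2 + 2 * ∑ j ∈ N i ∩ S, ‖y j - c‖ ^ 2 := by
          rw [Finset.sum_add_distrib, Finset.mul_sum, Finset.mul_sum]
      _ ≤ 2 * ∑ j ∈ N i, ‖y j - y i‖ ^ 2 + 2 * D := by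
          have h2 : ∑ j ∈ N i ∩ S, ‖y j - y i‖ ^ 2 ≤ ∑ j ∈ N i, ‖y j - y i‖ ^ 2 :=
            Finset.sum_le_sum_of_subset_of_nonneg Finset.inter_subset_left
              fun j _ _ => sq_nonneg _
          have h3 : ∑ j ∈ N i ∩ S, ‖y j - c‖ ^ 2 ≤ D :=
            Finset.sum_le_sum_of_subset_of_nonneg Finset.inter_subset_right
              fun j _ _ => sq_nonneg _
          linarith
  have h1 := Finset.sum_le_sum fun i (_ : i ∈ P) => hterm i
  rw [← Finset.mul_sum, Finset.sum_add_distrib, ← Finset.mul_sum, Finset.sum_const,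
    nsmul_eq_mul] at h1
  have h2 := mul_le_mul_of_nonneg_left (norm_avg_sub_sq_le hPne y c) hn'.le
  rw [hFy]
  refine le_of_mul_le_mul_left ?_ hp
  linarith

theorem IsCentered.mono {K K' : ℝ} (hK : K ≤ K') {F : (Fin n → Vec d) → Vec d}
    (hF : IsCentered f K F) : IsCentered f K' F := fun y S hS c =>
  (hF y S hS c).trans
    (mul_le_mul_of_nonneg_right hK (Finset.sum_nonneg fun _ _ => sq_nonneg _))

theorem IsBaseRule.isCentered {F : (Fin n → Vec d) → Vec d} (hF : IsBaseRule f F)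
    (hn : 2 * f < n) (hfn : 4 * f ≤ n) : IsCentered f 6 F := by
  rcases hF with rfl | rfl | hF | ⟨q, hq, hq', hF⟩
  · exact (isCentered_cwtm hn).mono (by norm_num)
  · exact (isCentered_cwmed hn).mono (by norm_num)
  · refine (hF.isCentered hn).mono ?_
    have h1 : (2 * f : ℝ) < n := by exact_mod_cast hn
    have h2 : (4 * f : ℝ) ≤ n := by exact_mod_cast hfn
    rw [div_le_iff₀ (by linarith)]
    linarith
  · exact hF.isCentered hq hq' hn

end BaseRules

/-! ### Bounds on the robustness coefficient -/

section Coefficient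

variable {n d f : ℕ}

/-- No rule has a robustness coefficient below `f / (n - 2 f)`: when `n - f` inputs vanish, the
output must vanish, although the other `f` inputs together with `n - 2 f` vanishing ones could be
the honest ones. -/
theorem IsRobust.le_coefficient [Nontrivial (Vec d)] {κ : ℝ} {A : (Fin n → Vec d) → Vec d}
    (hA : IsRobust f κ A) (hf : 0 < f) (hn : 2 * f < n) : (f : ℝ) / (n - 2 * f) ≤ κ := by
  obtain ⟨e, he⟩ := exists_ne (0 : Vec d)
  have he' : 0 < ‖e‖ := norm_pos_iff.2 he
  have hf' : (0 : ℝ) < f := by exact_mod_cast hf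
  have hn' : (0 : ℝ) < n - 2 * f := by
    have : (2 * f : ℝ) < n := by exact_mod_cast hn
    linarith
  obtain ⟨P, -, hP⟩ := Finset.exists_subset_card_eq (s := (Finset.univ : Finset (Fin n)))
    (n := f) (by rw [Finset.card_univ, Fintype.card_fin]; omega)
  obtain ⟨S, hPS, -, hS⟩ := Finset.exists_subsuperset_card_eq (Finset.subset_univ P)
    (n := n - f) (by omega) (by rw [Finset.card_univ, Fintype.card_fin]; omega)
  set x : Fin n → Vec d := fun i => if i ∈ P then e else 0
  have hcard : (S.card : ℝ) = n - f := by rw [hS, Nat.cast_sub (by omega)]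
  have hzero : A x = 0 := by
    have hPc : (Pᶜ : Finset (Fin n)).card = n - f := by
      rw [Finset.card_compl, hP, Fintype.card_fin]
    have hxz : ∀ i ∈ Pᶜ, x i = 0 := fun i hi => if_neg (Finset.mem_compl.1 hi)
    have havg : avg Pᶜ x = 0 := by rw [avg, Finset.sum_eq_zero hxz, smul_zero]
    have h := hA x Pᶜ hPc
    rw [havg, Finset.sum_eq_zero (fun i hi => by simp [hxz i hi]), mul_zero, sub_zero] at h
    exact norm_eq_zero.1 (pow_eq_zero_iff two_ne_zero |>.1 (le_antisymm h (sq_nonneg _)))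
  have hSne : S.Nonempty := Finset.card_pos.1 (by omega)
  have hxP : ∀ i ∈ P, x i = e := fun i hi => if_pos hi
  have hxP' : ∀ i ∉ P, x i = 0 := fun i hi => if_neg hi
  have hsum : ∑ i ∈ S, x i = (f : ℝ) • e := by
    rw [← Finset.sum_subset hPS fun i _ hi => hxP' i hi, Finset.sum_congr rfl hxP,
      Finset.sum_const, hP, Nat.cast_smul_eq_nsmul]
  have hsq : ∑ i ∈ S, ‖x i‖ ^ 2 = f * ‖e‖ ^ 2 := by
    rw [← Finset.sum_subset hPS fun i _ hi => by simp [hxP' i hi],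
      Finset.sum_congr rfl fun i hi => by rw [hxP i hi], Finset.sum_const, hP, nsmul_eq_mul]
  have hnorm : S.card * ‖avg S x‖ = f * ‖e‖ := by
    rw [← Real.norm_natCast S.card, ← norm_smul, card_smul_avg hSne, hsum, norm_smul,
      Real.norm_natCast]
  have hvar := sum_norm_sub_sq hSne x 0
  simp only [sub_zero, hsq] at hvar
  have h := hA x S hS
  rw [hzero, zero_sub, norm_neg] at h
  rw [div_mul_eq_mul_div, le_div_iff₀ (by linarith)] at h
  set a := ‖avg S x‖
  set V := ∑ i ∈ S, ‖x i - avg S x‖ ^ 2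
  rw [hcard] at hnorm hvar h
  have hs : (0 : ℝ) < n - f := by linarith
  have hV : (n - f) * V = f * (n - 2 * f) * ‖e‖ ^ 2 := by
    have : V = f * ‖e‖ ^ 2 - (n - f) * a ^ 2 := by linarith
    rw [this]
    linear_combination (-((n : ℝ) - f) * a - f * ‖e‖) * hnorm
  have h2 : (f * ‖e‖) ^ 2 ≤ κ * (f * (n - 2 * f) * ‖e‖ ^ 2) := by
    rw [← hV, ← hnorm]
    nlinarith
  rw [div_le_iff₀ hn']
  refine le_of_mul_le_mul_left (a := f * ‖e‖ ^ 2) ?_ (by positivity)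
  linarith

theorem kappaBound_le (hf : 640 * f < n) : kappaBound n f ≤ 48 * f / (n - 2 * f) := by
  have h1 : (640 * f : ℝ) < n := by exact_mod_cast hf
  have h0 : (0 : ℝ) ≤ f := Nat.cast_nonneg f
  have h2 : (f : ℝ) / (n - 2 * f) ≤ 1 := div_le_one_of_le₀ (by linarith) (by linarith)
  have h3 : 0 ≤ (f : ℝ) / (n - 2 * f) := div_nonneg h0 (by linarith)
  have h4 : 1 + (1 + (f : ℝ) / (n - 2 * f)) ^ 2 ≤ 5 := by nlinarith
  calc kappaBound n f ≤ 8 * f / (n - f) * 5 :=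
        mul_le_mul_of_nonneg_left h4 (div_nonneg (by linarith) (by linarith))
    _ ≤ 48 * f / (n - 2 * f) := by
        rw [div_mul_eq_mul_div]
        exact div_le_div₀ (by linarith) (by linarith) (by linarith) (by linarith)

theorem coefficient_le {F : (Fin n → Vec d) → Vec d} (hF : IsBaseRule f F)
    {M : (Fin n → Vec d) → Fin n → Vec d} (hM : IsNNM f M) (hfn : 640 * f < n) {κ : ℝ}
    (hκ : κ ≤ kappaBound n f ∨ IsLeast {κ' : ℝ | IsRobust f κ' (normCap (F ∘ M))} κ) :
    κ ≤ 48 * f / (n - 2 * f) := by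
  rcases hκ with h | h
  · exact h.trans (kappaBound_le hfn)
  · refine h.2 (IsRobust.normCap ?_)
    have := (hF.isCentered (by omega) (by omega)).isRobust_comp_nnm (by norm_num) hM (by omega)
    norm_num at this
    exact this

end Coefficient

/-! ### Smooth losses -/

section Smooth

variable {n d : ℕ}

theorem differentiable_localLoss {m : ℕ} {Z : Type*} {ℓ : Vec d → Z → ℝ}
    (hℓ : ∀ z : Z, Differentiable ℝ (fun θ => ℓ θ z)) (D : Fin n → Fin m → Z) (i : Fin n) :
    Differentiable ℝ (localLoss ℓ D i) :=
  (Differentiable.fun_sum fun k _ => hℓ (D i k)).const_mul _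

theorem differentiable_honestLoss {Lc : Fin n → Vec d → ℝ} (hLc : ∀ i, Differentiable ℝ (Lc i))
    (H : Finset (Fin n)) : Differentiable ℝ (honestLoss Lc H) :=
  (Differentiable.fun_sum fun i _ => hLc i).const_mul _

theorem gradient_honestLoss {Lc : Fin n → Vec d → ℝ} (hLc : ∀ i, Differentiable ℝ (Lc i))
    (H : Finset (Fin n)) (θ : Vec d) :
    gradient (honestLoss Lc H) θ = avg H fun i => gradient (Lc i) θ := by
  have h : HasFDerivAt (honestLoss Lc H) ((H.card : ℝ)⁻¹ • ∑ i ∈ H, fderiv ℝ (Lc i) θ) θ :=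
    (HasFDerivAt.fun_sum fun i _ => (hLc i θ).hasFDerivAt).const_mul _
  rw [gradient, h.fderiv, avg, map_smul, map_sum]
  rfl

theorem IsSmooth.continuous_gradient {L : ℝ} {g : Vec d → ℝ} (hg : IsSmooth L g) :
    Continuous (gradient g) :=
  (LipschitzWith.of_dist_le_mul (K := L.toNNReal) fun x y => by
    rw [dist_eq_norm, dist_eq_norm]
    exact (hg x y).trans
      (mul_le_mul_of_nonneg_right (Real.le_coe_toNNReal L) (norm_nonneg _))).continuous

theorem isSmooth_honestLoss {Lc : Fin n → Vec d → ℝ} (hLc : ∀ i, Differentiable ℝ (Lc i))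
    {H : Finset (Fin n)} {L : ℝ} (hL : 0 ≤ L) (hsmooth : ∀ i ∈ H, IsSmooth L (Lc i)) :
    IsSmooth L (honestLoss Lc H) := fun θ θ' => by
  have h : gradient (honestLoss Lc H) θ - gradient (honestLoss Lc H) θ'
      = avg H fun i => gradient (Lc i) θ - gradient (Lc i) θ' := by
    simp only [gradient_honestLoss hLc, avg, Finset.sum_sub_distrib, smul_sub]
  rw [h]
  exact norm_avg_le _ (by positivity) fun i hi => hsmooth i hi θ θ'

/-- The quadratic upper bound for a function with `L`-Lipschitz gradient. -/
theorem IsSmooth.le_quadratic {L : ℝ} {g : Vec d → ℝ} (hg : IsSmooth L g)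
    (hd : Differentiable ℝ g) (x v : Vec d) :
    g (x + v) ≤ g x + inner ℝ (gradient g x) v + L / 2 * ‖v‖ ^ 2 := by
  set φ : ℝ → ℝ := fun t => g (x + t • v) - t * inner ℝ (gradient g x) v - L / 2 * t ^ 2 * ‖v‖ ^ 2
  have hφ : ∀ t, HasDerivAt φ (inner ℝ (gradient g (x + t • v)) v - inner ℝ (gradient g x) v
      - L * t * ‖v‖ ^ 2) t := fun t => by
    have h1 : HasDerivAt (fun t : ℝ => x + t • v) v t := by
      simpa using ((hasDerivAt_id t).smul_const v).const_add x
    have h2 : HasDerivAt (fun t : ℝ => g (x + t • v)) (inner ℝ (gradient g (x + t • v)) v) t := by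
      rw [inner_gradient_left]
      exact (hd (x + t • v)).hasFDerivAt.comp_hasDerivAt t h1
    have h3 : HasDerivAt (fun t : ℝ => t * inner ℝ (gradient g x) v)
        (inner ℝ (gradient g x) v) t := by
      simpa using (hasDerivAt_id t).mul_const (inner ℝ (gradient g x) v)
    have h4 : HasDerivAt (fun t : ℝ => L / 2 * t ^ 2 * ‖v‖ ^ 2) (L * t * ‖v‖ ^ 2) t :=
      (((hasDerivAt_pow 2 t).const_mul (L / 2)).mul_const (‖v‖ ^ 2)).congr_deriv (by
        push_cast
        ring)
    exact (h2.sub h3).sub h4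
  have hanti : AntitoneOn φ (Set.Icc 0 1) := by
    refine antitoneOn_of_deriv_nonpos (convex_Icc 0 1)
      (fun t _ => (hφ t).continuousAt.continuousWithinAt)
      (fun t _ => (hφ t).differentiableAt.differentiableWithinAt) fun t ht => ?_
    rw [interior_Icc] at ht
    rw [(hφ t).deriv, ← inner_sub_left]
    have h1 := real_inner_le_norm (gradient g (x + t • v) - gradient g x) v
    have h2 := hg (x + t • v) x
    rw [add_sub_cancel_left, norm_smul, Real.norm_of_nonneg ht.1.le] at h2
    have h3 := mul_le_mul_of_nonneg_right h2 (norm_nonneg v)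
    nlinarith
  have h := hanti (Set.left_mem_Icc.2 zero_le_one) (Set.right_mem_Icc.2 zero_le_one) zero_le_one
  simp only [φ, one_smul, zero_smul, add_zero, one_mul, zero_mul, one_pow, mul_one, sub_zero,
    ne_eq, OfNat.ofNat_ne_zero, not_false_eq_true, zero_pow, mul_zero] at h
  linarith

/-- One step of inexact gradient descent: `r` replaces the gradient. -/
theorem IsSmooth.descent {L γ : ℝ} {g : Vec d → ℝ} (hg : IsSmooth L g)
    (hd : Differentiable ℝ g) (hγ : 0 ≤ γ) (hγL : γ * L ≤ 1) (x r : Vec d) :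
    γ / 2 * ‖gradient g x‖ ^ 2
      ≤ g x - g (x - γ • r) + γ / 2 * ‖r - gradient g x‖ ^ 2 := by
  have h := hg.le_quadratic hd x (-(γ • r))
  rw [← sub_eq_add_neg, inner_neg_right, real_inner_smul_right, norm_neg, norm_smul,
    Real.norm_of_nonneg hγ, mul_pow] at h
  rw [norm_sub_sq_real, real_inner_comm]
  have h1 := mul_le_mul_of_nonneg_right hγL (mul_nonneg hγ (sq_nonneg ‖r‖))
  nlinarith

end Smooth

/-! ### Trajectories of robust gradient descent -/

section Trajectory

variable {n d : ℕ} {Lc : Fin n → Vec d → ℝ} {H : Finset (Fin n)} {R : (Fin n → Vec d) → Vec d}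
  {γ L : ℝ} {T : ℕ} {θ : ℕ → Vec d} {g : ℕ → Fin n → Vec d}

/-- Since the update is no longer than the longest honest gradient, the latter grows by a factor of
at most `1 + γ L` per step. -/
theorem IsRobustDGD.norm_gradient_le (hrun : IsRobustDGD Lc H R γ T θ g)
    (hR : ∀ (x : Fin n → Vec d) (b : ℝ), (∀ i ∈ H, ‖x i‖ ≤ b) → ‖R x‖ ≤ b)
    (hsmooth : ∀ i ∈ H, IsSmooth L (Lc i)) (hL : 0 ≤ L) (hγ : 0 ≤ γ) {ζ : ℝ}
    (hζ : ∀ i ∈ H, ‖gradient (Lc i) (θ 1)‖ ≤ ζ) (s : ℕ) (hs : s ≤ T) :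
    ∀ i ∈ H, ‖gradient (Lc i) (θ (s + 1))‖ ≤ (1 + γ * L) ^ s * ζ := by
  induction s with
  | zero => simpa using hζ
  | succ s ih =>
    intro i hi
    have ih' := ih (by omega)
    have hr : ‖R (g (s + 1))‖ ≤ (1 + γ * L) ^ s * ζ := hR _ _ fun j hj => by
      rw [hrun.honest (s + 1) (by omega) hs j hj]
      exact ih' j hj
    have h1 := hsmooth i hi (θ (s + 1 + 1)) (θ (s + 1))
    rw [hrun.step (s + 1) (by omega) hs, sub_sub_cancel_left, norm_neg, norm_smul,
      Real.norm_of_nonneg hγ] at h1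
    have h2 := mul_le_mul_of_nonneg_left hr (mul_nonneg hL hγ)
    have h3 := norm_le_norm_add_norm_sub' (gradient (Lc i) (θ (s + 1 + 1)))
      (gradient (Lc i) (θ (s + 1)))
    have h4 := ih' i hi
    rw [hrun.step (s + 1) (by omega) hs] at h3 ⊢
    calc _ ≤ (1 + γ * L) ^ s * ζ + L * γ * ((1 + γ * L) ^ s * ζ) := by linarith
      _ = (1 + γ * L) ^ (s + 1) * ζ := by ring

theorem IsRobustDGD.norm_gradient_le_exp (hrun : IsRobustDGD Lc H R γ T θ g)
    (hR : ∀ (x : Fin n → Vec d) (b : ℝ), (∀ i ∈ H, ‖x i‖ ≤ b) → ‖R x‖ ≤ b)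
    (hsmooth : ∀ i ∈ H, IsSmooth L (Lc i)) (hL : 0 ≤ L) (hγ : 0 ≤ γ) {ζ : ℝ} (hζ0 : 0 ≤ ζ)
    (hζ : ∀ i ∈ H, ‖gradient (Lc i) (θ 1)‖ ≤ ζ) {a : ℝ} (ha : γ * L * T ≤ a) (t : ℕ)
    (ht : t ∈ Finset.Icc 1 T) : ∀ i ∈ H, ‖gradient (Lc i) (θ t)‖ ≤ Real.exp a * ζ := by
  intro i hi
  rw [Finset.mem_Icc] at ht
  obtain ⟨s, rfl⟩ : ∃ s, t = s + 1 := ⟨t - 1, by omega⟩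
  refine (hrun.norm_gradient_le hR hsmooth hL hγ hζ s (by omega) i hi).trans ?_
  refine mul_le_mul_of_nonneg_right ?_ hζ0
  have h0 : 0 ≤ γ * L := mul_nonneg hγ hL
  have hsT : (s : ℝ) ≤ T := by exact_mod_cast (by omega : s ≤ T)
  calc (1 + γ * L) ^ s ≤ Real.exp (γ * L) ^ s :=
        pow_le_pow_left₀ (by linarith) (by linarith [Real.add_one_le_exp (γ * L)]) s
    _ = Real.exp (s * (γ * L)) := (Real.exp_nat_mul _ _).symm
    _ ≤ Real.exp a := Real.exp_le_exp.2 (by nlinarith)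

/-- The descent inequality summed along the trajectory. -/
theorem IsRobustDGD.sum_sq_gradient_le (hrun : IsRobustDGD Lc H R γ T θ g) {Φ : Vec d → ℝ}
    (hΦ : IsSmooth L Φ) (hd : Differentiable ℝ Φ) (hγ : 0 ≤ γ) (hγL : γ * L ≤ 1) {δ : ℝ}
    (hδ : ∀ t ∈ Finset.Icc 1 T, ‖R (g t) - gradient Φ (θ t)‖ ^ 2 ≤ δ) :
    γ / 2 * ∑ t ∈ Finset.Icc 1 T, ‖gradient Φ (θ t)‖ ^ 2
      ≤ Φ (θ 1) - Φ (θ (T + 1)) + γ / 2 * (T * δ) := by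
  have h : ∀ t ∈ Finset.Icc 1 T, γ / 2 * ‖gradient Φ (θ t)‖ ^ 2
      ≤ -(Φ (θ (t + 1)) - Φ (θ t)) + γ / 2 * δ := fun t ht => by
    have h1 := hΦ.descent hd hγ hγL (θ t) (R (g t))
    rw [← hrun.step t (Finset.mem_Icc.1 ht).1 (Finset.mem_Icc.1 ht).2] at h1
    have h2 := mul_le_mul_of_nonneg_left (hδ t ht) (div_nonneg hγ zero_le_two)
    linarith
  have htel : ∑ t ∈ Finset.Icc 1 T, (Φ (θ (t + 1)) - Φ (θ t)) = Φ (θ (T + 1)) - Φ (θ 1) := by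
    rw [← Finset.Ico_add_one_right_eq_Icc]
    exact Finset.sum_Ico_sub (fun t => Φ (θ t)) (by omega)
  have h1 := Finset.sum_le_sum h
  rw [← Finset.mul_sum, Finset.sum_add_distrib, Finset.sum_neg_distrib, htel, Finset.sum_const,
    Nat.card_Icc, nsmul_eq_mul, Nat.add_sub_cancel] at h1
  linarith

theorem expectedSqGrad_eq {Φ : Vec d → ℝ} (hΦ : Continuous (gradient Φ)) (θ : ℕ → Vec d)
    (T : ℕ) : expectedSqGrad Φ θ T
      = (T : ℝ)⁻¹ * ∑ t ∈ Finset.Icc 1 T, ‖gradient Φ (θ t)‖ ^ 2 := by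
  have hcount : (Measure.count (Set.Icc 1 T) : ENNReal) = T := by
    rw [← Finset.coe_Icc, Measure.count_apply_finset, Nat.card_Icc, Nat.add_sub_cancel]
  have hint : IntegrableOn (fun t => ‖gradient Φ (θ t)‖ ^ 2) (Finset.Icc 1 T) Measure.count := by
    rw [← (Finset.Icc 1 T : Set ℕ).biUnion_of_singleton]
    exact (integrableOn_finite_biUnion (Finset.finite_toSet _)).2 fun t _ =>
      integrableOn_singleton (by simp) (by simp)
  have hmeas : Continuous fun x => ‖gradient Φ x‖ ^ 2 := hΦ.norm.pow 2
  rw [expectedSqGrad, outputLaw, integral_map (measurable_of_countable θ).aemeasurable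
    hmeas.aestronglyMeasurable, uniformOn, ProbabilityTheory.cond, integral_smul_measure, hcount,
    ← Finset.coe_Icc, setIntegral_finset _ hint]
  simp [Measure.real]

end Trajectory

/-! ### The error bounds -/

section Bounds

variable {n d f : ℕ}

theorem one_le_amplification {B : ℝ} : 1 ≤ (1 + 1 / B ^ 2) ^ 2 := by
  have : 0 ≤ 1 / B ^ 2 := by positivity
  nlinarith

theorem four_le_amplification_mul {B : ℝ} (hB : 0 < B) : 4 ≤ (1 + 1 / B ^ 2) ^ 2 * B ^ 2 := by
  have e : (1 + 1 / B ^ 2) ^ 2 * B ^ 2 = (B - 1 / B) ^ 2 + 4 := by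
    field_simp
    ring
  rw [e]
  linarith [sq_nonneg (B - 1 / B)]

theorem Psi_mul_sq {G B ρ : ℝ} (hG : 0 < G) :
    Psi G B ρ * G ^ 2 = 640 * (1 + 1 / B ^ 2) ^ 2 * (G ^ 2 + B ^ 2 * ρ ^ 2) := by
  rw [Psi]
  field_simp

theorem mul_Psi_mul_epsO {G B ρ ξ : ℝ} (hG : 0 < G) (hξ : 0 < ξ)
    (hf : (f : ℝ) / n = (1 - ξ) * breakdownPoint B) :
    ξ * Psi G B ρ * epsO n f G B
      = 160 * (1 + 1 / B ^ 2) ^ 2 * (G ^ 2 + B ^ 2 * ρ ^ 2) * ((f : ℝ) / n) := by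
  have h : 1 - (2 + B ^ 2) * ((f : ℝ) / n) = ξ := by
    rw [hf, breakdownPoint]
    have : (0 : ℝ) < 2 + B ^ 2 := by positivity
    field_simp
    ring
  rw [epsO, h]
  generalize (f : ℝ) / n = φ
  calc ξ * Psi G B ρ * (1 / 4 * (G ^ 2 * φ / ξ)) = Psi G B ρ * G ^ 2 * (φ / 4) := by field_simp
    _ = _ := by
      rw [Psi_mul_sq hG]
      ring

/-- The average squared gradient along a trajectory whose honest gradients are bounded by `ρ`: the
optimization error is `2 κ G²`, since `γ T = Δ / (κ G²)`, and the aggregation error is the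
robustness coefficient of `A ∘ arc` times the heterogeneity. -/
theorem average_sq_gradient_le {Lc : Fin n → Vec d → ℝ} {H : Finset (Fin n)}
    {A : (Fin n → Vec d) → Vec d} {γ L G B κ Lstar Δ ρ : ℝ} {T : ℕ} {θ : ℕ → Vec d}
    {g : ℕ → Fin n → Vec d} (hrun : IsRobustDGD Lc H (A ∘ arc f) γ T θ g)
    (hA : IsRobust f κ A) (hκ : 0 < κ) (hf : 0 < f) (hn : 2 * f < n) (hH : H.card = n - f)
    (hLc : ∀ i, Differentiable ℝ (Lc i)) (hL : 0 < L) (hsmooth : ∀ i ∈ H, IsSmooth L (Lc i))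
    (hG : 0 < G) (hGB : GradientDissimilarity Lc H G B) (hT : 1 ≤ T)
    (hLstar : IsGLB (Set.range (honestLoss Lc H)) Lstar)
    (hΔ : honestLoss Lc H (θ 1) - Lstar ≤ Δ)
    (hγ : γ = Δ / (κ * G ^ 2) * (1 / (T : ℝ))) (hγL : γ * L ≤ 1)
    (hρ : ∀ t ∈ Finset.Icc 1 T, ‖gradient (honestLoss Lc H) (θ t)‖ ≤ ρ) :
    (T : ℝ)⁻¹ * ∑ t ∈ Finset.Icc 1 T, ‖gradient (honestLoss Lc H) (θ t)‖ ^ 2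
      ≤ 2 * κ * G ^ 2 + (κ + 2 * f / (n - 2 * f)) * (G ^ 2 + B ^ 2 * ρ ^ 2) := by
  set Φ := honestLoss Lc H with hΦ
  have hT0 : (0 : ℝ) < T := by exact_mod_cast hT
  have hn' : (2 * f : ℝ) < n := by exact_mod_cast hn
  have hlow : ∀ x, Lstar ≤ Φ x := fun x => hLstar.1 ⟨x, rfl⟩
  have hΔ0 : 0 ≤ Δ := by linarith [hlow (θ 1)]
  have hγ0 : 0 ≤ γ := by rw [hγ]; positivity
  have hd : Differentiable ℝ Φ := differentiable_honestLoss hLc H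
  set κ' : ℝ := κ + 2 * f / (n - 2 * f) with hκ'
  have hκ'0 : 0 ≤ κ' :=
    add_nonneg hκ.le (div_nonneg (by positivity) (by linarith))
  have hδ : ∀ t ∈ Finset.Icc 1 T,
      ‖(A ∘ arc f) (g t) - gradient Φ (θ t)‖ ^ 2 ≤ κ' * (G ^ 2 + B ^ 2 * ρ ^ 2) := fun t ht => by
    have hg : ∀ i ∈ H, g t i = gradient (Lc i) (θ t) :=
      hrun.honest t (Finset.mem_Icc.1 ht).1 (Finset.mem_Icc.1 ht).2
    have havg : avg H (g t) = gradient Φ (θ t) := by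
      rw [hΦ, gradient_honestLoss hLc, avg, avg, Finset.sum_congr rfl hg]
    have h := hA.comp_arc hκ.le hf hn (g t) H hH
    rw [havg, Finset.sum_congr rfl fun i hi => by rw [hg i hi], div_eq_mul_inv, mul_assoc] at h
    refine h.trans (mul_le_mul_of_nonneg_left ((hGB (θ t)).trans ?_) hκ'0)
    have := pow_le_pow_left₀ (norm_nonneg _) (hρ t ht) 2
    have := mul_le_mul_of_nonneg_left this (sq_nonneg B)
    linarith
  have hE0 : 0 ≤ G ^ 2 + B ^ 2 * ρ ^ 2 := by positivity
  rcases hΔ0.eq_or_lt with h0 | hΔpos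
  · -- the learning rate is zero and the starting point is a minimizer
    have hγz : γ = 0 := by rw [hγ, ← h0]; simp
    have hconst : ∀ s, s ≤ T → θ (s + 1) = θ 1 := fun s => by
      induction s with
      | zero => intro _; rfl
      | succ s ih =>
        intro hs
        rw [hrun.step (s + 1) (by omega) hs, hγz, zero_smul, sub_zero, ih (by omega)]
    have hmin : gradient Φ (θ 1) = 0 := by
      have h1 : IsLocalMin Φ (θ 1) :=
        Filter.Eventually.of_forall fun x => by linarith [hlow x]
      rw [gradient, h1.fderiv_eq_zero, map_zero]
    have hz : ∑ t ∈ Finset.Icc 1 T, ‖gradient Φ (θ t)‖ ^ 2 = 0 := by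
      refine Finset.sum_eq_zero fun t ht => ?_
      obtain ⟨s, rfl⟩ : ∃ s, t = s + 1 := ⟨t - 1, by have := (Finset.mem_Icc.1 ht).1; omega⟩
      rw [hconst s (by have := (Finset.mem_Icc.1 ht).2; omega), hmin]
      simp
    rw [hz, mul_zero]
    positivity
  have hγpos : 0 < γ := by rw [hγ]; positivity
  have h := hrun.sum_sq_gradient_le (isSmooth_honestLoss hLc hL.le hsmooth) hd hγ0 hγL hδ
  have h1 : Φ (θ 1) - Φ (θ (T + 1)) ≤ γ / 2 * (T * (2 * κ * G ^ 2)) := by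
    have e : γ / 2 * (T * (2 * κ * G ^ 2)) = Δ := by
      rw [hγ]
      field_simp
    rw [e]
    linarith [hlow (θ (T + 1))]
  rw [inv_mul_le_iff₀ hT0]
  refine le_of_mul_le_mul_left ?_ (half_pos hγpos)
  linarith

end Bounds

end ARC

theorem mainTheorem3
    {n d m f : ℕ} {Z : Type*}
    -- data, point-wise loss and local losses
    (hm : 0 < m) (ℓ : ARC.Vec d → Z → ℝ) (D : Fin n → Fin m → Z)
    (hℓ : ∀ z : Z, Differentiable ℝ (fun θ => ℓ θ z))
    -- honest workers
    (hn : 2 * f < n) (H : Finset (Fin n)) (hH : H.card = n - f)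
    -- smoothness and heterogeneity
    (L : ℝ) (hL : 0 < L) (hsmooth : ∀ i ∈ H, ARC.IsSmooth L (ARC.localLoss ℓ D i))
    (G B : ℝ) (hG : 0 < G) (hB : 0 < B)
    (hGB : ARC.GradientDissimilarity (ARC.localLoss ℓ D) H G B)
    -- the aggregation `F ∘ NNM`, capped in norm, and its robustness coefficient
    (F : (Fin n → ARC.Vec d) → ARC.Vec d) (hF : ARC.IsBaseRule f F)
    (M : (Fin n → ARC.Vec d) → Fin n → ARC.Vec d) (hM : ARC.IsNNM f M)
    (A : (Fin n → ARC.Vec d) → ARC.Vec d) (hA : A = ARC.normCap (F ∘ M))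
    (κ : ℝ) (hκ : ARC.IsRobust f κ A)
    (hκ' : κ ≤ ARC.kappaBound n f ∨ IsLeast {κ' : ℝ | ARC.IsRobust f κ' A} κ)
    -- an execution of Robust-DGD with aggregation `A ∘ ARC`
    (T : ℕ) (hT : 1 ≤ T) (γ : ℝ) (θ : ℕ → ARC.Vec d) (g : ℕ → Fin n → ARC.Vec d)
    (hrun : ARC.IsRobustDGD (ARC.localLoss ℓ D) H (A ∘ ARC.arc f) γ T θ g)
    -- initial suboptimality and initial gradients
    (Lstar Δo : ℝ)
    (hLstar : IsGLB (Set.range (ARC.honestLoss (ARC.localLoss ℓ D) H)) Lstar)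
    (hΔo : ARC.honestLoss (ARC.localLoss ℓ D) H (θ 1) - Lstar ≤ Δo)
    (ζ : ℝ) (hζ : ∀ i ∈ H, ‖gradient (ARC.localLoss ℓ D i) (θ 1)‖ ≤ ζ)
    -- learning rate and number of steps
    (hγ : γ = min (Δo / (κ * G ^ 2) * (1 / (T : ℝ))) (1 / L))
    (hTΔ : Δo * L / (κ * G ^ 2) ≤ (T : ℝ))
    (ξo : ℝ) (hξo : ξo ∈ Set.Ioo (0 : ℝ) 1)
    (ρ : ℝ) (hρ : ρ = Real.exp ((2 + B ^ 2) * Δo / ((1 - ξo) * G ^ 2) * L) * ζ) :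
    (∀ ξ ∈ Set.Ioc (0 : ℝ) ξo, (f : ℝ) / n = (1 - ξ) * ARC.breakdownPoint B →
      ARC.expectedSqGrad (ARC.honestLoss (ARC.localLoss ℓ D) H) θ T
        ≤ ξ * ARC.Psi G B ρ * ARC.epsO n f G B) ∧
    (ARC.breakdownPoint B ≤ (f : ℝ) / n → (f : ℝ) / n < 1 / 2 →
      ARC.expectedSqGrad (ARC.honestLoss (ARC.localLoss ℓ D) H) θ T
        ≤ ARC.Psi G B ρ * (G ^ 2 / 8)) := by
  have hn0 : (0 : ℝ) < n := by exact_mod_cast (by omega : 0 < n)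
  have hn' : (2 * f : ℝ) < n := by exact_mod_cast hn
  have hT0 : (0 : ℝ) < T := by exact_mod_cast hT
  have hf0 : (0 : ℝ) ≤ f := Nat.cast_nonneg f
  have hBP : 0 < ARC.breakdownPoint B := by rw [ARC.breakdownPoint]; positivity
  have hξ1 : 0 < 1 - ξo := by linarith [hξo.2]
  set Lc := ARC.localLoss ℓ D
  set Φ := ARC.honestLoss Lc H with hΦ
  have hLc : ∀ i, Differentiable ℝ (Lc i) := ARC.differentiable_localLoss hℓ D
  have hcont : Continuous (gradient Φ) :=
    (ARC.isSmooth_honestLoss hLc hL.le hsmooth).continuous_gradient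
  have hHne : H.Nonempty := Finset.card_pos.1 (by omega)
  have hζ0 : 0 ≤ ζ := (norm_nonneg _).trans (hζ _ hHne.choose_spec)
  have hρ0 : 0 ≤ ρ := by rw [hρ]; positivity
  have hΔ0 : 0 ≤ Δo := by
    have : Lstar ≤ Φ (θ 1) := hLstar.1 ⟨θ 1, rfl⟩
    linarith
  set Q : ℝ := (1 + 1 / B ^ 2) ^ 2 with hQ
  have hQ1 : 1 ≤ Q := ARC.one_le_amplification
  have hQ4 : 4 ≤ Q * B ^ 2 := ARC.four_le_amplification_mul hB
  have hE0 : 0 < G ^ 2 + B ^ 2 * ρ ^ 2 := by positivity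
  have hQρ : 4 * ρ ^ 2 ≤ Q * (G ^ 2 + B ^ 2 * ρ ^ 2) := by
    have h1 := mul_le_mul_of_nonneg_right hQ4 (sq_nonneg ρ)
    have h2 : 0 ≤ Q * G ^ 2 := by positivity
    linarith
  -- `expectedSqGrad` is bounded as soon as the gradients along the trajectory are
  have hexp : ∀ b : ℝ, (∀ t ∈ Finset.Icc 1 T, ‖gradient Φ (θ t)‖ ≤ b) →
      ARC.expectedSqGrad Φ θ T ≤ b ^ 2 := fun b hb => by
    rw [ARC.expectedSqGrad_eq hcont, inv_mul_le_iff₀ hT0]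
    have h := Finset.sum_le_sum fun t ht => pow_le_pow_left₀ (norm_nonneg _) (hb t ht) 2
    rwa [Finset.sum_const, Nat.card_Icc, Nat.add_sub_cancel, nsmul_eq_mul] at h
  have hpos : ∀ a : ℝ, 0 < a → a * ARC.breakdownPoint B ≤ (f : ℝ) / n → 0 < f :=
    fun a ha h => by
      have h1 : 0 < (f : ℝ) / n := (mul_pos ha hBP).trans_le h
      have h2 : (f : ℝ) ≠ 0 := fun h0 => by rw [h0, zero_div] at h1; exact lt_irrefl _ h1
      exact Nat.pos_of_ne_zero (by exact_mod_cast h2)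
  rcases subsingleton_or_nontrivial (ARC.Vec d) with hsub | hnt
  · have h0 : ARC.expectedSqGrad Φ θ T ≤ 0 := by
      have := hexp 0 fun t _ => by rw [Subsingleton.elim (gradient Φ (θ t)) 0, norm_zero]
      simpa using this
    refine ⟨fun ξ hξ hfn => h0.trans ?_, fun _ _ => h0.trans ?_⟩
    · rw [ARC.mul_Psi_mul_epsO hG hξ.1 hfn]
      positivity
    · rw [ARC.Psi]
      positivity
  have hκf : 0 < f → (f : ℝ) / (n - 2 * f) ≤ κ := fun hf => hκ.le_coefficient hf hn
  have hκpos : 0 < f → 0 < κ := fun hf =>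
    (div_pos (by exact_mod_cast hf) (by linarith)).trans_le (hκf hf)
  have hTγ : 0 < f → γ = Δo / (κ * G ^ 2) * (1 / (T : ℝ)) := fun hf => by
    have := hκpos hf
    rw [hγ, min_eq_left]
    rw [div_mul_div_comm, mul_one, div_le_div_iff₀ (by positivity) hL, one_mul]
    rwa [div_le_iff₀ (by positivity), mul_comm (T : ℝ)] at hTΔ
  have hγL : γ * L ≤ 1 := by
    have h1 : γ ≤ 1 / L := hγ.trans_le (min_le_right _ _)
    rwa [le_div_iff₀ hL] at h1
  have hR : ∀ (x : Fin n → ARC.Vec d) (b : ℝ), (∀ i ∈ H, ‖x i‖ ≤ b) → ‖(A ∘ ARC.arc f) x‖ ≤ b :=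
    fun x b hb => by
      rw [hA]
      exact ARC.norm_normCap_arc_le hn _ x hH hb
  have hbound : (1 - ξo) * ARC.breakdownPoint B ≤ (f : ℝ) / n →
      ∀ t ∈ Finset.Icc 1 T, ‖gradient Φ (θ t)‖ ≤ ρ := fun hfn t ht => by
    have hf := hpos _ hξ1 hfn
    have hκ0 := hκpos hf
    have hγ0 : 0 ≤ γ := by rw [hTγ hf]; positivity
    -- the lower bound on `κ` bounds the total step length `γ T`
    have hκBP : (1 - ξo) / (2 + B ^ 2) ≤ κ := by
      have h1 : (1 - ξo) / (2 + B ^ 2) ≤ (f : ℝ) / n := by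
        rwa [ARC.breakdownPoint, mul_one_div] at hfn
      exact h1.trans ((div_le_div_of_nonneg_left hf0 (by linarith) (by linarith)).trans (hκf hf))
    have ha : γ * L * T ≤ (2 + B ^ 2) * Δo / ((1 - ξo) * G ^ 2) * L := by
      have e : γ * L * T = Δo / (κ * G ^ 2) * L := by
        rw [hTγ hf]
        field_simp
      have h1 : (1 - ξo) ≤ κ * (2 + B ^ 2) := by rwa [div_le_iff₀ (by positivity)] at hκBP
      rw [e]
      refine mul_le_mul_of_nonneg_right ?_ hL.le
      rw [div_le_div_iff₀ (by positivity) (by positivity)]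
      have h2 := mul_le_mul_of_nonneg_left h1 (mul_nonneg hΔ0 (sq_nonneg G))
      linarith
    rw [hΦ, ARC.gradient_honestLoss hLc]
    refine ARC.norm_avg_le _ hρ0 fun i hi => ?_
    rw [hρ]
    exact hrun.norm_gradient_le_exp hR hsmooth hL.le hγ0 hζ0 hζ ha t ht i hi
  refine ⟨fun ξ hξ hfn => ?_, fun hfn _ => ?_⟩
  · have hfn' : (1 - ξo) * ARC.breakdownPoint B ≤ (f : ℝ) / n := by
      rw [hfn]
      exact mul_le_mul_of_nonneg_right (by linarith [hξ.2]) hBP.le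
    have hf := hpos _ hξ1 hfn'
    rw [ARC.mul_Psi_mul_epsO hG hξ.1 hfn, ← hQ]
    rcases le_or_gt n (640 * f) with h640 | h640
    · -- for `f / n ≥ 1 / 640` the bound `ρ` on the gradients is enough
      have h1 : 1 / 640 ≤ (f : ℝ) / n := by
        rw [div_le_div_iff₀ (by norm_num) hn0]
        have : (n : ℝ) ≤ 640 * f := by exact_mod_cast h640
        linarith
      have h2 := mul_le_mul_of_nonneg_left h1
        (by positivity : 0 ≤ 160 * Q * (G ^ 2 + B ^ 2 * ρ ^ 2))
      have h3 := hexp ρ (hbound hfn')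
      linarith
    · have h640' : (640 * f : ℝ) < n := by exact_mod_cast h640
      have hκ0 := hκpos hf
      have hκle : κ ≤ 48 * f / (n - 2 * f) := ARC.coefficient_le hF hM h640 (by rwa [hA] at hκ')
      have hsum : 2 * κ + (κ + 2 * f / (n - 2 * f)) ≤ 160 * ((f : ℝ) / n) := by
        have h1 : 146 * ((f : ℝ) / (n - 2 * f)) ≤ 160 * ((f : ℝ) / n) := by
          rw [mul_div_assoc', mul_div_assoc', div_le_div_iff₀ (by linarith) hn0]
          nlinarith
        rw [mul_div_assoc] at hκle ⊢
        linarith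
      rw [ARC.expectedSqGrad_eq hcont]
      refine (ARC.average_sq_gradient_le hrun hκ hκ0 hf hn hH hLc hL hsmooth hG hGB hT hLstar
        hΔo (hTγ hf) hγL (hbound hfn')).trans ?_
      have h1 : 2 * κ * G ^ 2 ≤ 2 * κ * (G ^ 2 + B ^ 2 * ρ ^ 2) :=
        mul_le_mul_of_nonneg_left (by linarith [mul_nonneg (sq_nonneg B) (sq_nonneg ρ)])
          (by linarith)
      have h2 := mul_le_mul_of_nonneg_right hsum hE0.le
      have h3 := mul_le_mul_of_nonneg_left hQ1
        (by positivity : 0 ≤ 160 * ((f : ℝ) / n) * (G ^ 2 + B ^ 2 * ρ ^ 2))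
      linarith
  · have hfn' : (1 - ξo) * ARC.breakdownPoint B ≤ (f : ℝ) / n :=
      (mul_le_of_le_one_left hBP.le (by linarith [hξo.1])).trans hfn
    have h1 := hexp ρ (hbound hfn')
    have h2 := ARC.Psi_mul_sq (B := B) (ρ := ρ) hG
    rw [← hQ] at h2
    linarith [sq_nonneg ρ]
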